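/- **Conventions.** A ringed space is a topological space with a sheaf of (not necessarily commutative) rings; modules are left modules. A simplicial ringed space $(\mathcal U,\mathcal R)=(U_p,\mathcal R_p)_{p\ge 0}$ is a simplicial object in the category of ringed spaces, with faces $\partial_i$ and degeneracies $s_i$. For $k\ge p$ let $\rho_{k,p}=\partial_{p+1}\cdots\partial_k$ and $\tau_{k,p}=\partial_0\cdots\partial_0:U_k\to U_p$ be the front and back face maps. The canonical isomorphisms $\varphi^*\psi^*\cong(\psi\varphi)^*$ and $\mathrm{id}^*\cong\mathrm{id}$ are treated as identities. For $\mathbb Z$-graded sheaves of $\mathcal R_0$-modules $E,F$ on $U_0$, an element $u$ of total degree $m$ of $C(\mathcal U,\mathrm{Hom}(E,F))$ is a family $u^{k,m-k}\in\mathrm{Hom}^{m-k}_{\mathcal R_k}(\tau_{k,0}^*E,\rho_{k,0}^*F)$, $k\ge0$. Put $$(\delta u)^{p+1,q}=\sum_{i=1}^{p}(-1)^i\partial_i^*u^{p,q},\quad (\delta u)^{0,q}=0,$$ and let the product $u\cdot v$ be the sum over the components of $u$ and $v$ of $$u^{p,q}\cdot v^{r,s}=(-1)^{qr}(\rho_{p+r,p}^*u^{p,q})\circ(\tau_{p+r,r}^*v^{r,s}),$$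 which has bidegree $(p+r,q+s)$. A *twisted complex* on $(\mathcal U,\mathcal R)$ is a pair $(E,a)$ of a $\mathbb Z$-graded sheaf $E$ of $\mathcal R_0$-modules and $a=(a^{k,1-k})_{k\ge0}$ of total degree $1$ in $C(\mathcal U,\mathrm{Hom}(E,E))$ such that $\delta a+a\cdot a=0$ and $a^{1,0}:(\tau_{1,0}^*E,\tau_{1,0}^*a^{0,1})\to(\rho_{1,0}^*E,\rho_{1,0}^*a^{0,1})$ is invertible up to homotopy. A morphism $\theta:(E,a)\to(F,b)$ of degree $m$ is an element of total degree $m$ of $C(\mathcal U,\mathrm{Hom}(E,F))$; its differential is $d\theta=\delta\theta+b\cdot\theta-(-1)^m\theta\cdot a$, and $\theta$ is closed if $d\theta=0$. It is a *weak equivalence* if it is closed of degree $0$ and its component $\theta^{0,0}:(E,a^{0,1})\to(F,b^{0,1})$ is a quasi-isomorphism of complexes of $\mathcal R_0$-modules on $U_0$. For a simplicial map $f:(\mathcal U,\mathcal R)\to(\mathcal V,\mathcal S)$ and a twisted complex $(E,a)$ on $(\mathcal V,\mathcal S)$, the twisted complex $f^*(E,a)$ is $(f_0^*E,(f_k^*a^{k,1-k})_k)$.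 A *simplicial homotopy* $h$ between simplicial maps $f,g:(\mathcal U,\mathcal R)\to(\mathcal V,\mathcal S)$ consists of morphisms $h_i=h_i^p:U_p\to V_{p+1}$, $0\le i\le p$, $p\ge0$, with $\partial_0h_0=f_p$, $\partial_{p+1}h_p=g_p$; $\partial_ih_j=h_{j-1}\partial_i$ if $i<j$, $\partial_ih_j=\partial_ih_{i-1}$ if $i=j\ne0$, $\partial_ih_j=h_j\partial_{i-1}$ if $i>j+1$; $s_ih_j=h_{j+1}s_i$ if $i\le j$, and $s_ih_j=h_js_{i-1}$ if $i>j$. **Proposition 3.5.** Let $f,g:(\mathcal U,\mathcal R)\to(\mathcal V,\mathcal S)$ be simplicial maps between simplicial ringed spaces, let $h$ be a simplicial homotopy between $f$ and $g$, and let $\mathcal E=(E,a)$ be a twisted complex on $(\mathcal V,\mathcal S)$. Since $\tau_{k+1,0}h_i=f_0\tau_{k,0}$ and $\rho_{k+1,0}h_i=g_0\rho_{k,0}$, the formula $$\Phi_0^{k,-k}(\mathcal E)=\sum_{i=0}^k(-1)^i\,h_i^*(a^{k+1,-k})\in\mathrm{Hom}^{-k}_{\mathcal R_k}(\tau_{k,0}^*f_0^*E,\rho_{k,0}^*g_0^*E),\qquad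 k\ge0,$$ defines a morphism $\Phi_0(\mathcal E):f^*\mathcal E\to g^*\mathcal E$ of degree $0$. This morphism is a weak equivalence: it is closed, $d\Phi_0(\mathcal E)=0$, and its $(0,0)$ component $h_0^*a^{1,0}:(f_0^*E,f_0^*a^{0,1})\to(g_0^*E,g_0^*a^{0,1})$ is a quasi-isomorphism of complexes of $\mathcal R_0$-modules on $U_0$. -/

import Mathlib

open CategoryTheory AlgebraicGeometry TopologicalSpace Opposite Limits Simplicial

universe u v

noncomputable section

namespace TwistedCx

/-! ### Graded objects and graded maps -/

section Graded

variable {C : Type u} [Category.{v} C]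
variable {D : Type u} [Category.{v} D]

/-- Maps of degree `q` between `ℤ`-graded objects `E` and `F`: a family of morphisms
`E n ⟶ F m`, one for each pair `(n, m)` with `n + q = m`. -/
@[ext]
structure GrHom (q : ℤ) (E F : ℤ → C) : Type v where
  /-- the component `E n ⟶ F m`, where `n + q = m` -/
  v (n m : ℤ) (h : n + q = m) : E n ⟶ F m

namespace GrHom

variable {q r s t : ℤ} {E F G H E₁ F₁ G₁ : ℤ → C}

lemma ext_v {x y : GrHom q E F} (h : ∀ n m hnm, x.v n m hnm = y.v n m hnm) : x = y :=
  GrHom.ext (by funext n m hnm; exact h n m hnm)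

/-- Composition `x ∘ y` (first `y`, then `x`) of maps of degrees `q` and `s`. -/
def comp (x : GrHom q F G) (y : GrHom s E F) (h : q + s = t) : GrHom t E G where
  v n m hnm := y.v n (n + s) rfl ≫ x.v (n + s) m (by omega)

lemma comp_v (x : GrHom q F G) (y : GrHom s E F) (h : q + s = t) (n k m : ℤ)
    (hnm : n + t = m) (hnk : n + s = k) (hkm : k + q = m) :
    (x.comp y h).v n m hnm = y.v n k hnk ≫ x.v k m hkm := by
  subst hnk
  rfl

/-- The identity, as a map of degree `0`. -/
def one (E : ℤ → C) : GrHom 0 E E where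
  v n m h := eqToHom (congrArg E (by omega))

lemma one_v (n : ℤ) : (one E).v n n (by omega) = 𝟙 (E n) := rfl

variable [Preadditive C] [Preadditive D]

instance : AddCommGroup (GrHom q E F) where
  add x y := ⟨fun n m h => x.v n m h + y.v n m h⟩
  zero := ⟨fun _ _ _ => 0⟩
  neg x := ⟨fun n m h => -x.v n m h⟩
  sub x y := ⟨fun n m h => x.v n m h - y.v n m h⟩
  nsmul k x := ⟨fun n m h => k • x.v n m h⟩
  zsmul k x := ⟨fun n m h => k • x.v n m h⟩
  add_assoc _ _ _ := GrHom.ext (by funext _ _ _; exact add_assoc _ _ _)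
  zero_add _ := GrHom.ext (by funext _ _ _; exact zero_add _)
  add_zero _ := GrHom.ext (by funext _ _ _; exact add_zero _)
  neg_add_cancel _ := GrHom.ext (by funext _ _ _; exact neg_add_cancel _)
  add_comm _ _ := GrHom.ext (by funext _ _ _; exact add_comm _ _)
  sub_eq_add_neg _ _ := GrHom.ext (by funext _ _ _; exact sub_eq_add_neg _ _)
  nsmul_zero _ := GrHom.ext (by funext _ _ _; exact zero_nsmul _)
  nsmul_succ _ _ := GrHom.ext (by funext _ _ _; exact succ_nsmul _ _)
  zsmul_zero' _ := GrHom.ext (by funext _ _ _; exact zero_zsmul _)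
  zsmul_succ' _ _ := GrHom.ext (by funext _ _ _; exact SubNegMonoid.zsmul_succ' _ _)
  zsmul_neg' _ _ := GrHom.ext (by funext _ _ _; exact SubNegMonoid.zsmul_neg' _ _)

@[simp] lemma zero_v (n m : ℤ) (h : n + q = m) : (0 : GrHom q E F).v n m h = 0 := rfl
@[simp] lemma add_v (x y : GrHom q E F) (n m : ℤ) (h : n + q = m) :
    (x + y).v n m h = x.v n m h + y.v n m h := rfl
@[simp] lemma neg_v (x : GrHom q E F) (n m : ℤ) (h : n + q = m) :
    (-x).v n m h = -x.v n m h := rfl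
@[simp] lemma sub_v (x y : GrHom q E F) (n m : ℤ) (h : n + q = m) :
    (x - y).v n m h = x.v n m h - y.v n m h := rfl
@[simp] lemma zsmul_v (k : ℤ) (x : GrHom q E F) (n m : ℤ) (h : n + q = m) :
    (k • x).v n m h = k • x.v n m h := rfl

/-- Rewriting the degree of a map along an equality. -/
def cast (h : q = r) : GrHom q E F →+ GrHom r E F where
  toFun x := ⟨fun n m hnm => x.v n m (by omega)⟩
  map_zero' := rfl
  map_add' _ _ := rfl

/-- The action of an additive functor on maps of degree `q`. -/
def map (Q : C ⥤ D) [Q.Additive] :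
    GrHom q E F →+ GrHom q (fun n => Q.obj (E n)) (fun n => Q.obj (F n)) where
  toFun x := ⟨fun n m h => Q.map (x.v n m h)⟩
  map_zero' := ext_v fun _ _ _ => Q.map_zero _ _
  map_add' _ _ := ext_v fun _ _ _ => Q.map_add

/-- Transport of maps of degree `q` along degreewise isomorphisms of source and target. -/
def conj (e : ∀ n, E n ≅ E₁ n) (f : ∀ n, F n ≅ F₁ n) : GrHom q E F →+ GrHom q E₁ F₁ where
  toFun x := ⟨fun n m h => (e n).inv ≫ x.v n m h ≫ (f m).hom⟩
  map_zero' := ext_v fun n m h => by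
    change (e n).inv ≫ (0 : E n ⟶ F m) ≫ (f m).hom = 0
    rw [zero_comp, comp_zero]
  map_add' x y := ext_v fun n m h => by
    change (e n).inv ≫ (x.v n m h + y.v n m h) ≫ (f m).hom =
      (e n).inv ≫ x.v n m h ≫ (f m).hom + (e n).inv ≫ y.v n m h ≫ (f m).hom
    rw [Preadditive.add_comp, Preadditive.comp_add]

@[simp] lemma cast_v (h : q = r) (x : GrHom q E F) (n m : ℤ) (hnm : n + r = m) :
    (cast h x).v n m hnm = x.v n m (by omega) := rfl

@[simp] lemma map_v (Q : C ⥤ D) [Q.Additive] (x : GrHom q E F) (n m : ℤ) (h : n + q = m) :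
    (map Q x).v n m h = Q.map (x.v n m h) := rfl

@[simp] lemma conj_v (e : ∀ n, E n ≅ E₁ n) (f : ∀ n, F n ≅ F₁ n) (x : GrHom q E F)
    (n m : ℤ) (h : n + q = m) :
    (conj e f x).v n m h = (e n).inv ≫ x.v n m h ≫ (f m).hom := rfl

lemma map_comp (Q : C ⥤ D) [Q.Additive] (x : GrHom q F G) (y : GrHom s E F)
    (h : q + s = t) : map Q (x.comp y h) = (map Q x).comp (map Q y) h := by
  apply ext_v
  intro n m hnm
  rw [map_v, comp_v _ _ _ n (n + s) m hnm rfl (by omega),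
    comp_v _ _ _ n (n + s) m hnm rfl (by omega), Q.map_comp, map_v, map_v]

lemma cast_comp {q₁ s₁ t₁ : ℤ} (x : GrHom q F G) (y : GrHom s E F) (h : q + s = t)
    (hq : q = q₁) (hs : s = s₁) (ht : t = t₁) :
    cast ht (x.comp y h) = (cast hq x).comp (cast hs y) (by omega) := by
  subst hq hs ht
  rfl

lemma conj_comp (e : ∀ n, E n ≅ E₁ n) (f : ∀ n, F n ≅ F₁ n) (g : ∀ n, G n ≅ G₁ n)
    (x : GrHom q F G) (y : GrHom s E F) (h : q + s = t) :
    conj e g (x.comp y h) = (conj f g x).comp (conj e f y) h := by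
  apply ext_v
  intro n m hnm
  rw [conj_v, comp_v _ _ _ n (n + s) m hnm rfl (by omega),
    comp_v _ _ _ n (n + s) m hnm rfl (by omega), conj_v, conj_v]
  simp

lemma map_one (Q : C ⥤ D) [Q.Additive] : map Q (one E) = one _ := by
  apply ext_v
  intro n m hnm
  obtain rfl : n = m := by omega
  rw [map_v, one_v, one_v, Q.map_id]

lemma conj_one (e : ∀ n, E n ≅ E₁ n) : conj e e (one E) = one _ := by
  apply ext_v
  intro n m hnm
  obtain rfl : n = m := by omega
  rw [conj_v, one_v, one_v]
  simp

/-- Given maps `dE`, `dF` of degree `1` on `E` and `F` (differentials in the applications),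
`x` is invertible up to homotopy: there is `y` of degree `0` commuting with the differentials
such that `y ∘ x` and `x ∘ y` are homotopic to the identities. -/
def IsHomotopyInvertible (dE : GrHom 1 E E) (dF : GrHom 1 F F) (x : GrHom 0 E F) : Prop :=
  ∃ (y : GrHom 0 F E) (σ : GrHom (-1) E E) (τ : GrHom (-1) F F),
    dE.comp y (add_zero 1) = y.comp dF (zero_add 1) ∧
    y.comp x (zero_add 0) - one E =
      dE.comp σ (add_neg_cancel 1) + σ.comp dE (neg_add_cancel 1) ∧
    x.comp y (zero_add 0) - one F =
      dF.comp τ (add_neg_cancel 1) + τ.comp dF (neg_add_cancel 1)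

lemma IsHomotopyInvertible.map {dE : GrHom 1 E E} {dF : GrHom 1 F F} {x : GrHom 0 E F}
    (h : IsHomotopyInvertible dE dF x) (Q : C ⥤ D) [Q.Additive] :
    IsHomotopyInvertible (GrHom.map Q dE) (GrHom.map Q dF) (GrHom.map Q x) := by
  obtain ⟨y, σ, τ, h₁, h₂, h₃⟩ := h
  refine ⟨GrHom.map Q y, GrHom.map Q σ, GrHom.map Q τ, ?_, ?_, ?_⟩
  · simp only [← map_comp, h₁]
  · simp only [← map_comp, ← map_one, ← _root_.map_sub, ← _root_.map_add, h₂]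
  · simp only [← map_comp, ← map_one, ← _root_.map_sub, ← _root_.map_add, h₃]

lemma IsHomotopyInvertible.conj {dE : GrHom 1 E E} {dF : GrHom 1 F F} {x : GrHom 0 E F}
    (h : IsHomotopyInvertible dE dF x) (e : ∀ n, E n ≅ E₁ n) (f : ∀ n, F n ≅ F₁ n) :
    IsHomotopyInvertible (GrHom.conj e e dE) (GrHom.conj f f dF) (GrHom.conj e f x) := by
  obtain ⟨y, σ, τ, h₁, h₂, h₃⟩ := h
  refine ⟨GrHom.conj f e y, GrHom.conj e e σ, GrHom.conj f f τ, ?_, ?_, ?_⟩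
  · simp only [← conj_comp, h₁]
  · simp only [← conj_comp, ← conj_one e, ← _root_.map_sub, ← _root_.map_add, h₂]
  · simp only [← conj_comp, ← conj_one f, ← _root_.map_sub, ← _root_.map_add, h₃]

end GrHom

end Graded

/-! ### Ringed spaces, sheaves of modules and inverse images -/

/-- Ringed spaces: a topological space with a sheaf of not necessarily commutative rings. -/
abbrev NCRingedSpace := SheafedSpace.{u + 1, u, u} RingCat.{u}

section Modules

variable {W X Y Z : NCRingedSpace.{u}}

/-- The structure sheaf, as a sheaf of rings on the site of open subsets. -/
abbrev ringSheaf (X : NCRingedSpace.{u}) :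
    Sheaf (Opens.grothendieckTopology X) RingCat.{u} :=
  ⟨X.presheaf, X.IsSheaf⟩

/-- Sheaves of left modules over the structure sheaf. -/
def Mod (X : NCRingedSpace.{u}) : Type (u + 1) := SheafOfModules.{u} (ringSheaf X)

instance : Category.{u} (Mod X) := inferInstanceAs (Category (SheafOfModules.{u} (ringSheaf X)))

instance : Abelian (Mod X) := inferInstanceAs (Abelian (SheafOfModules.{u} (ringSheaf X)))

/-- The morphism of sheaves of rings `𝒪_Y ⟶ f_* 𝒪_X` of a morphism of ringed spaces. -/
abbrev sheafHom (f : X ⟶ Y) : ringSheaf Y ⟶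
    ((Opens.map f.hom.base).sheafPushforwardContinuous RingCat.{u}
      (Opens.grothendieckTopology Y) (Opens.grothendieckTopology X)).obj (ringSheaf X) :=
  ⟨f.hom.c⟩

instance (f : X ⟶ Y) : (PresheafOfModules.pushforward.{u} (sheafHom f).hom).IsRightAdjoint :=
  inferInstance

instance (f : X ⟶ Y) : (SheafOfModules.pushforward.{u} (sheafHom f)).IsRightAdjoint :=
  inferInstance

/-- The direct image `f_*` on sheaves of modules. -/
def pushforward (f : X ⟶ Y) : Mod X ⥤ Mod Y := SheafOfModules.pushforward (sheafHom f)

/-- The inverse image `f^*` on sheaves of modules, left adjoint to the direct image. -/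
def pullback (f : X ⟶ Y) : Mod Y ⥤ Mod X := SheafOfModules.pullback (sheafHom f)

/-- The adjunction between inverse and direct image. -/
def pullbackAdj (f : X ⟶ Y) : pullback f ⊣ pushforward f :=
  SheafOfModules.pullbackPushforwardAdjunction _

instance (f : X ⟶ Y) : (pullback f).IsLeftAdjoint := (pullbackAdj f).isLeftAdjoint

instance (f : X ⟶ Y) : (pullback f).Additive :=
  let _ := preservesBinaryBiproducts_of_preservesBinaryCoproducts (pullback f)
  Functor.additive_of_preservesBinaryBiproducts _

/-- The canonical isomorphism `𝟙^* ≅ id`. -/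
def pullbackId (X : NCRingedSpace.{u}) : pullback (𝟙 X) ≅ 𝟭 _ :=
  SheafOfModules.pullbackId (ringSheaf X)

/-- The canonical isomorphism `f^* g^* ≅ (f ≫ g)^*`. -/
def pullbackComp (f : X ⟶ Y) (g : Y ⟶ Z) : pullback g ⋙ pullback f ≅ pullback (f ≫ g) :=
  SheafOfModules.pullbackComp (sheafHom g) (sheafHom f)

/-- The canonical isomorphism `φ^* β^* M ≅ γ^* M` for a commutative triangle `φ ≫ β = γ`. -/
def tri (φ : X ⟶ Y) (β : Y ⟶ Z) (γ : X ⟶ Z) (w : φ ≫ β = γ) (M : Mod Z) :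
    (pullback φ).obj ((pullback β).obj M) ≅ (pullback γ).obj M :=
  (pullbackComp φ β).app M ≪≫ eqToIso (by rw [w])

lemma tri_naturality (φ : X ⟶ Y) (β : Y ⟶ Z) (γ : X ⟶ Z) (w : φ ≫ β = γ) {M N : Mod Z}
    (x : M ⟶ N) :
    (pullback φ).map ((pullback β).map x) ≫ (tri φ β γ w N).hom =
      (tri φ β γ w M).hom ≫ (pullback γ).map x := by
  subst w
  simpa [tri] using (pullbackComp φ β).hom.naturality x

/-- The canonical isomorphisms are compatible with compositions. -/
lemma tri_assoc (ψ : W ⟶ X) (φ : X ⟶ Y) (β : Y ⟶ Z) (χ : W ⟶ Y) (γ : X ⟶ Z) (ε : W ⟶ Z)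
    (h₁ : ψ ≫ φ = χ) (h₂ : φ ≫ β = γ) (h₃ : ψ ≫ γ = ε) (h₄ : χ ≫ β = ε) (M : Mod Z) :
    (pullback ψ).map (tri φ β γ h₂ M).hom ≫ (tri ψ γ ε h₃ M).hom =
      (tri ψ φ χ h₁ ((pullback β).obj M)).hom ≫ (tri χ β ε h₄ M).hom := by
  subst h₁ h₂ h₃
  have h := congr_arg (fun e => e.hom.app M)
    (SheafOfModules.pullback_assoc.{u} (sheafHom β) (sheafHom φ) (sheafHom ψ))
  have h' : (pullback ψ).map ((pullbackComp φ β).hom.app M) ≫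
        (pullbackComp ψ (φ ≫ β)).hom.app M =
      (pullbackComp ψ φ).hom.app ((pullback β).obj M) ≫
        (pullbackComp (ψ ≫ φ) β).hom.app M := h.symm
  simp only [tri, eqToIso_refl, Iso.trans_refl, Iso.app_hom, Iso.trans_hom, eqToIso.hom]
  refine h'.trans (congrArg (fun z => (pullbackComp ψ φ).hom.app _ ≫ z) ?_)
  exact (Category.comp_id _).symm

lemma tri_id (β : X ⟶ Z) (w : 𝟙 X ≫ β = β) (M : Mod Z) :
    (tri (𝟙 X) β β w M).hom = (pullbackId X).hom.app ((pullback β).obj M) := by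
  have h := congr_arg (fun e => e.hom.app M)
    (SheafOfModules.pullback_comp_id.{u} (sheafHom β))
  have h' : (pullbackComp (𝟙 X) β).hom.app M =
      (pullbackId X).hom.app ((pullback β).obj M) := h
  simp only [tri, Iso.app_hom, Iso.trans_hom, eqToIso.hom]
  rw [h']
  exact Category.comp_id _

section Pull

variable {Y' Z' V' V Z'' : NCRingedSpace.{u}} {q s t : ℤ}

/-- The degreewise inverse image of a graded sheaf of modules. -/
abbrev pb (f : X ⟶ Y) (E : ℤ → Mod Y) : ℤ → Mod X := fun n => (pullback f).obj (E n)

/-- The inverse image `φ^* x : (φ ≫ β)^* E ⟶ (φ ≫ γ)^* F` of a graded map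
`x : β^* E ⟶ γ^* F`, with the canonical identifications `φ^* β^* = (φ ≫ β)^*` and
`φ^* γ^* = (φ ≫ γ)^*`. -/
def pull (φ : X ⟶ Y) {β : Y ⟶ Z} {γ : Y ⟶ Z'} {β' : X ⟶ Z} {γ' : X ⟶ Z'}
    (hβ : φ ≫ β = β') (hγ : φ ≫ γ = γ') {E : ℤ → Mod Z} {F : ℤ → Mod Z'} :
    GrHom q (pb β E) (pb γ F) →+ GrHom q (pb β' E) (pb γ' F) :=
  (GrHom.conj (fun n => tri φ β β' hβ (E n)) (fun n => tri φ γ γ' hγ (F n))).comp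
    (GrHom.map (pullback φ))

/-- A graded map `(β ≫ f)^* E ⟶ (γ ≫ g)^* F` seen as a graded map
`β^* (f^* E) ⟶ γ^* (g^* F)` through the canonical identifications. -/
def unsplit {β : X ⟶ Y} {γ : X ⟶ Y'} (f : Y ⟶ Z) (g : Y' ⟶ Z')
    {E : ℤ → Mod Z} {F : ℤ → Mod Z'} :
    GrHom q (pb (β ≫ f) E) (pb (γ ≫ g) F) →+ GrHom q (pb β (pb f E)) (pb γ (pb g F)) :=
  GrHom.conj (fun n => (tri β f _ rfl (E n)).symm) (fun n => (tri γ g _ rfl (F n)).symm)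

/-- The canonical isomorphism `β^* M ≅ M` when `β` is the identity. -/
def idIso {β : X ⟶ X} (hβ : β = 𝟙 X) (M : Mod X) : (pullback β).obj M ≅ M :=
  eqToIso (by rw [hβ]) ≪≫ (pullbackId X).app M

/-- A graded map `β^* E ⟶ γ^* F` seen as a graded map `E ⟶ F` when `β` and `γ` are the
identity. -/
def strip {β γ : X ⟶ X} (hβ : β = 𝟙 X) (hγ : γ = 𝟙 X) {E F : ℤ → Mod X} :
    GrHom q (pb β E) (pb γ F) →+ GrHom q E F :=
  GrHom.conj (fun n => idIso hβ (E n)) (fun n => idIso hγ (F n))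

lemma pull_v (φ : X ⟶ Y) {β : Y ⟶ Z} {γ : Y ⟶ Z'} {β' : X ⟶ Z} {γ' : X ⟶ Z'}
    (hβ : φ ≫ β = β') (hγ : φ ≫ γ = γ') {E : ℤ → Mod Z} {F : ℤ → Mod Z'}
    (x : GrHom q (pb β E) (pb γ F)) (n m : ℤ) (h : n + q = m) :
    (pull φ hβ hγ x).v n m h =
      (tri φ β β' hβ (E n)).inv ≫ (pullback φ).map (x.v n m h) ≫
        (tri φ γ γ' hγ (F m)).hom := rfl

lemma unsplit_v {β : X ⟶ Y} {γ : X ⟶ Y'} (f : Y ⟶ Z) (g : Y' ⟶ Z')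
    {E : ℤ → Mod Z} {F : ℤ → Mod Z'} (x : GrHom q (pb (β ≫ f) E) (pb (γ ≫ g) F))
    (n m : ℤ) (h : n + q = m) :
    (unsplit f g x).v n m h =
      (tri β f _ rfl (E n)).hom ≫ x.v n m h ≫ (tri γ g _ rfl (F m)).inv := rfl

lemma strip_v {β γ : X ⟶ X} (hβ : β = 𝟙 X) (hγ : γ = 𝟙 X) {E F : ℤ → Mod X}
    (x : GrHom q (pb β E) (pb γ F)) (n m : ℤ) (h : n + q = m) :
    (strip hβ hγ x).v n m h =
      (idIso hβ (E n)).inv ≫ x.v n m h ≫ (idIso hγ (F m)).hom := rfl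

lemma pull_comp (φ : X ⟶ Y) {β : Y ⟶ Z} {γ : Y ⟶ Z'} {ε : Y ⟶ Z''} {β' : X ⟶ Z}
    {γ' : X ⟶ Z'} {ε' : X ⟶ Z''} (hβ : φ ≫ β = β') (hγ : φ ≫ γ = γ') (hε : φ ≫ ε = ε')
    {E : ℤ → Mod Z} {F : ℤ → Mod Z'} {G : ℤ → Mod Z''}
    (x : GrHom q (pb γ F) (pb ε G)) (y : GrHom s (pb β E) (pb γ F)) (h : q + s = t) :
    pull φ hβ hε (x.comp y h) = (pull φ hγ hε x).comp (pull φ hβ hγ y) h := by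
  simp only [pull, AddMonoidHom.comp_apply, GrHom.map_comp]
  exact GrHom.conj_comp _ _ _ _ _ _

lemma pull_one (φ : X ⟶ Y) {β : Y ⟶ Z} {β' : X ⟶ Z} (hβ : φ ≫ β = β') {E : ℤ → Mod Z} :
    pull φ hβ hβ (GrHom.one (pb β E)) = GrHom.one (pb β' E) := by
  simp only [pull, AddMonoidHom.comp_apply, GrHom.map_one]
  exact GrHom.conj_one _

lemma unsplit_comp {V'' : NCRingedSpace.{u}} {β : X ⟶ Y} {γ : X ⟶ Y'} {ε : X ⟶ V''}
    (f : Y ⟶ Z) (g : Y' ⟶ Z') (k : V'' ⟶ Z'')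
    {E : ℤ → Mod Z} {F : ℤ → Mod Z'} {G : ℤ → Mod Z''}
    (x : GrHom q (pb (γ ≫ g) F) (pb (ε ≫ k) G)) (y : GrHom s (pb (β ≫ f) E) (pb (γ ≫ g) F))
    (h : q + s = t) :
    unsplit f k (x.comp y h) = (unsplit g k x).comp (unsplit f g y) h :=
  GrHom.conj_comp _ _ _ _ _ _

lemma unsplit_one {β : X ⟶ Y} (f : Y ⟶ Z) {E : ℤ → Mod Z} :
    unsplit f f (GrHom.one (pb (β ≫ f) E)) = GrHom.one (pb β (pb f E)) :=
  GrHom.conj_one _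

lemma strip_comp {β γ ε : X ⟶ X} (hβ : β = 𝟙 X) (hγ : γ = 𝟙 X) (hε : ε = 𝟙 X)
    {E F G : ℤ → Mod X} (x : GrHom q (pb γ F) (pb ε G)) (y : GrHom s (pb β E) (pb γ F))
    (h : q + s = t) :
    strip hβ hε (x.comp y h) = (strip hγ hε x).comp (strip hβ hγ y) h :=
  GrHom.conj_comp _ _ _ _ _ _

lemma pull_pull (ψ : W ⟶ X) (φ : X ⟶ Y) (χ : W ⟶ Y) (h : ψ ≫ φ = χ)
    {β : Y ⟶ Z} {γ : Y ⟶ Z'} {β' : X ⟶ Z} {γ' : X ⟶ Z'} {β'' : W ⟶ Z} {γ'' : W ⟶ Z'}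
    (hβ : φ ≫ β = β') (hγ : φ ≫ γ = γ') (hβ' : ψ ≫ β' = β'') (hγ' : ψ ≫ γ' = γ'')
    (hβ'' : χ ≫ β = β'') (hγ'' : χ ≫ γ = γ'')
    {E : ℤ → Mod Z} {F : ℤ → Mod Z'} (x : GrHom q (pb β E) (pb γ F)) :
    pull ψ hβ' hγ' (pull φ hβ hγ x) = pull χ hβ'' hγ'' x := by
  apply GrHom.ext_v
  intro n m hnm
  simp only [pull_v, Functor.map_comp, Category.assoc]
  have h₁ := tri_assoc ψ φ β χ β' β'' h hβ hβ' hβ'' (E n)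
  have h₂ := tri_assoc ψ φ γ χ γ' γ'' h hγ hγ' hγ'' (F m)
  have h₃ := tri_naturality ψ φ χ h (x.v n m hnm)
  rw [Iso.inv_comp_eq, ← cancel_epi ((pullback ψ).map (tri φ β β' hβ (E n)).hom),
    ← Functor.map_comp_assoc, Iso.hom_inv_id, CategoryTheory.Functor.map_id,
    Category.id_comp, h₂, reassoc_of% h₃, reassoc_of% h₁, Iso.hom_inv_id_assoc]

lemma pull_id {φ : X ⟶ X} (h : φ = 𝟙 X) {β : X ⟶ Z} {γ : X ⟶ Z'}
    (hβ : φ ≫ β = β) (hγ : φ ≫ γ = γ)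
    {E : ℤ → Mod Z} {F : ℤ → Mod Z'} (x : GrHom q (pb β E) (pb γ F)) :
    pull φ hβ hγ x = x := by
  subst h
  apply GrHom.ext_v
  intro n m hnm
  rw [pull_v, Iso.inv_comp_eq, tri_id, tri_id]
  exact (pullbackId X).hom.naturality (x.v n m hnm)

lemma strip_pull {φ : X ⟶ X} (h : φ = 𝟙 X) {β γ β' γ' : X ⟶ X} (w : φ ≫ β = β')
    (w' : φ ≫ γ = γ') (hβ : β = 𝟙 X) (hγ : γ = 𝟙 X) (hβ' : β' = 𝟙 X) (hγ' : γ' = 𝟙 X)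
    {E F : ℤ → Mod X} (x : GrHom q (pb β E) (pb γ F)) :
    strip hβ' hγ' (pull φ w w' x) = strip hβ hγ x := by
  obtain rfl : β = β' := by rw [hβ, hβ']
  obtain rfl : γ = γ' := by rw [hγ, hγ']
  rw [pull_id h]

lemma pull_unsplit (φ : W ⟶ X) {β : X ⟶ Y} {γ : X ⟶ Y'} {β' : W ⟶ Y} {γ' : W ⟶ Y'}
    (f : Y ⟶ Z) (g : Y' ⟶ Z') (hβ : φ ≫ β = β') (hγ : φ ≫ γ = γ')
    (hβf : φ ≫ β ≫ f = β' ≫ f) (hγg : φ ≫ γ ≫ g = γ' ≫ g)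
    {E : ℤ → Mod Z} {F : ℤ → Mod Z'} (x : GrHom q (pb (β ≫ f) E) (pb (γ ≫ g) F)) :
    pull φ hβ hγ (unsplit f g x) = unsplit f g (pull φ hβf hγg x) := by
  apply GrHom.ext_v
  intro n m hnm
  have h₁ := tri_assoc φ β f β' (β ≫ f) (β' ≫ f) hβ rfl hβf rfl (E n)
  have h₂ := tri_assoc φ γ g γ' (γ ≫ g) (γ' ≫ g) hγ rfl hγg rfl (F m)
  simp only [pull_v, unsplit_v, Functor.map_comp, Category.assoc]
  rw [Iso.inv_comp_eq, ← reassoc_of% h₁, Iso.hom_inv_id_assoc]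
  congr 2
  rw [← cancel_epi ((pullback φ).map (tri γ g (γ ≫ g) rfl (F m)).hom),
    ← Functor.map_comp_assoc, Iso.hom_inv_id, CategoryTheory.Functor.map_id,
    Category.id_comp, reassoc_of% h₂, Iso.hom_inv_id, Category.comp_id]

end Pull

end Modules

/-! ### Simplicial ringed spaces: front and back faces -/

section Simplicial

variable {U V : SimplicialObject NCRingedSpace.{u}}

/-- The front face map `ρ_{k,p} : U_k ⟶ U_p`, induced by `[p] → [k]`, `i ↦ i`; it is the
composite of the face maps `∂_k`, ..., `∂_{p+1}`. -/
def rho (U : SimplicialObject NCRingedSpace.{u}) (k p : ℕ) (h : p ≤ k) : U _⦋k⦌ ⟶ U _⦋p⦌ :=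
  U.map (SimplexCategory.subinterval 0 p (by omega)).op

/-- The back face map `τ_{k,p} : U_k ⟶ U_p`, induced by `[p] → [k]`, `i ↦ i + (k - p)`; it is
the composite of `k - p` copies of `∂_0`. -/
def tau (U : SimplicialObject NCRingedSpace.{u}) (k p : ℕ) (h : p ≤ k) : U _⦋k⦌ ⟶ U _⦋p⦌ :=
  U.map (SimplexCategory.subinterval (k - p) p (by omega)).op

lemma rho_rho {k p r : ℕ} (h : p ≤ k) (h' : r ≤ p) :
    rho U k p h ≫ rho U p r h' = rho U k r (h'.trans h) := by
  unfold rho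
  rw [← Functor.map_comp, ← op_comp]
  congr 2

lemma tau_tau {k p r : ℕ} (h : p ≤ k) (h' : r ≤ p) :
    tau U k p h ≫ tau U p r h' = tau U k r (h'.trans h) := by
  unfold tau
  rw [← Functor.map_comp, ← op_comp]
  congr 2
  ext i : 3
  apply Fin.ext
  change (i.1 + (p - r)) + (k - p) = i.1 + (k - r)
  omega

lemma tau_rho {k p r : ℕ} (hp : p ≤ k) (hr : r ≤ k) (h : p + r = k) :
    tau U k r hr ≫ rho U r 0 (Nat.zero_le r) = rho U k p hp ≫ tau U p 0 (Nat.zero_le p) := by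
  unfold tau rho
  rw [← Functor.map_comp, ← op_comp, ← Functor.map_comp, ← op_comp]
  congr 2
  ext i : 3
  apply Fin.ext
  change (i.1 + 0) + (k - r) = (i.1 + (p - 0)) + 0
  omega

lemma rho_self (p : ℕ) : rho U p p le_rfl = 𝟙 _ := by
  unfold rho
  rw [← U.map_id, ← op_id]
  congr 2

lemma tau_self (p : ℕ) : tau U p p le_rfl = 𝟙 _ := by
  unfold tau
  rw [← U.map_id, ← op_id]
  congr 2
  ext i : 3
  apply Fin.ext
  change i.1 + (p - p) = i.1
  omega

lemma rho_succ (k p : ℕ) (h : p ≤ k) :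
    rho U (k + 1) p (h.trans k.le_succ) = U.δ (Fin.last (k + 1)) ≫ rho U k p h := by
  unfold rho SimplicialObject.δ
  rw [← Functor.map_comp, ← op_comp]
  congr 2
  ext i : 3
  apply Fin.ext
  change i.1 + 0 = ((Fin.last (k + 1)).succAbove ⟨i.1 + 0, _⟩).1
  rw [Fin.succAbove_last]
  rfl

lemma tau_succ (k p : ℕ) (h : p ≤ k) :
    tau U (k + 1) p (h.trans k.le_succ) = U.δ 0 ≫ tau U k p h := by
  unfold tau SimplicialObject.δ
  rw [← Functor.map_comp, ← op_comp]
  congr 2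
  ext i : 3
  apply Fin.ext
  change i.1 + (k + 1 - p) = ((0 : Fin (k + 2)).succAbove
    (⟨i.1 + (k - p), by have := i.2; simp only [SimplexCategory.len_mk] at this; omega⟩ :
      Fin (k + 1))).1
  rw [Fin.succAbove_zero]
  change _ = i.1 + (k - p) + 1
  omega

lemma δ_rho (k : ℕ) (i : Fin k) :
    U.δ (i.succ.castSucc : Fin (k + 2)) ≫ rho U k 0 k.zero_le =
      rho U (k + 1) 0 (k + 1).zero_le := by
  unfold rho SimplicialObject.δ
  rw [← Functor.map_comp, ← op_comp]
  congr 2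
  ext j : 3
  obtain rfl : j = 0 := Subsingleton.elim (α := Fin 1) _ _
  change (i.succ.castSucc : Fin (k + 2)).succAbove 0 = 0
  rw [Fin.succAbove_of_castSucc_lt _ _ (by simp [Fin.lt_def])]
  rfl

lemma δ_tau (k : ℕ) (i : Fin k) :
    U.δ (i.succ.castSucc : Fin (k + 2)) ≫ tau U k 0 k.zero_le =
      tau U (k + 1) 0 (k + 1).zero_le := by
  unfold tau SimplicialObject.δ
  rw [← Functor.map_comp, ← op_comp]
  congr 2
  ext j : 3
  obtain rfl : j = 0 := Subsingleton.elim (α := Fin 1) _ _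
  apply Fin.ext
  change ((i.succ.castSucc : Fin (k + 2)).succAbove
    (⟨0 + (k - 0), by omega⟩ : Fin (k + 1))).1 = 0 + (k + 1 - 0)
  rw [Fin.succAbove_of_le_castSucc _ _ (by simp [Fin.le_def])]
  simp

lemma rho_naturality (f : U ⟶ V) {k p : ℕ} (h : p ≤ k) :
    f.app (op ⦋k⦌) ≫ rho V k p h = rho U k p h ≫ f.app (op ⦋p⦌) :=
  (f.naturality _).symm

lemma tau_naturality (f : U ⟶ V) {k p : ℕ} (h : p ≤ k) :
    f.app (op ⦋k⦌) ≫ tau V k p h = tau U k p h ≫ f.app (op ⦋p⦌) :=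
  (f.naturality _).symm

end Simplicial

/-! ### The bigraded modules of maps -/

section Cochains

variable {U V : SimplicialObject NCRingedSpace.{u}}

/-- Elements of total degree `m` of `C(U, Hom(E, F))`: families
`x^{k, m-k} ∈ Hom^{m-k}(τ_{k,0}^* E, ρ_{k,0}^* F)`, `k ≥ 0`. -/
abbrev Coch (U : SimplicialObject NCRingedSpace.{u}) (E F : ℤ → Mod (U _⦋0⦌)) (m : ℤ) :
    Type u :=
  ∀ k : ℕ, GrHom (m - k) (pb (tau U k 0 k.zero_le) E) (pb (rho U k 0 k.zero_le) F)

variable {E F G : ℤ → Mod (U _⦋0⦌)} {m n t : ℤ}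

/-- The product of `x ∈ C(U, Hom(F, G))` and `y ∈ C(U, Hom(E, F))`; for components of bidegrees
`(p, q)` and `(r, s)` it is `(-1)^{qr} (ρ_{p+r,p}^* x^{p,q}) ∘ (τ_{p+r,r}^* y^{r,s})`. -/
def mul (x : Coch U F G m) (y : Coch U E F n) (h : m + n = t) : Coch U E G t := fun k =>
  ∑ p : Fin (k + 1), (((m - (p : ℕ)) * ((k - p : ℕ) : ℤ)).negOnePow : ℤ) •
    (pull (rho U k p (by omega)) rfl (rho_rho _ _) (x p)).comp
      (pull (tau U k (k - p) (by omega)) (tau_tau _ _) (tau_rho _ _ (by omega)) (y (k - p)))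
      (by omega)

/-- The differential `(δ x)^{p+1,q} = ∑_{i=1}^{p} (-1)^i ∂_i^* x^{p,q}`. -/
def delta (x : Coch U E F m) (h : m + 1 = n) : Coch U E F n := fun k =>
  match k with
  | 0 => 0
  | p + 1 => ∑ i : Fin p, ((-1 : ℤ) ^ (i.1 + 1)) •
      GrHom.cast (by push_cast; omega)
        (pull (U.δ (i.succ.castSucc : Fin (p + 2))) (δ_tau p i) (δ_rho p i) (x p))

/-- The inverse image of `x ∈ C(V, Hom(E, F))` under a simplicial map `f : U ⟶ V`, with components
`f_k^* x^{k,m-k}`. -/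
def cochPullback (f : U ⟶ V) {E F : ℤ → Mod (V _⦋0⦌)} (x : Coch V E F m) :
    Coch U (pb (f.app (op ⦋0⦌)) E) (pb (f.app (op ⦋0⦌)) F) m := fun k =>
  unsplit (f.app (op ⦋0⦌)) (f.app (op ⦋0⦌))
    (pull (f.app (op ⦋k⦌)) (tau_naturality f _) (rho_naturality f _) (x k))

lemma cochPullback_zero (f : U ⟶ V) {E F : ℤ → Mod (V _⦋0⦌)} :
    cochPullback f (0 : Coch V E F m) = 0 := by
  funext k
  simp [cochPullback]

lemma cochPullback_add (f : U ⟶ V) {E F : ℤ → Mod (V _⦋0⦌)} (x y : Coch V E F m) :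
    cochPullback f (x + y) = cochPullback f x + cochPullback f y := by
  funext k
  simp [cochPullback]

lemma pull_cast {q s : ℤ} {X Y Z Z' : NCRingedSpace.{u}} (φ : X ⟶ Y) {β : Y ⟶ Z} {γ : Y ⟶ Z'}
    {β' : X ⟶ Z} {γ' : X ⟶ Z'} (hβ : φ ≫ β = β') (hγ : φ ≫ γ = γ') {E : ℤ → Mod Z}
    {F : ℤ → Mod Z'} (h : q = s) (x : GrHom q (pb β E) (pb γ F)) :
    pull φ hβ hγ (GrHom.cast h x) = GrHom.cast h (pull φ hβ hγ x) := rfl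

lemma unsplit_cast {q s : ℤ} {X Y Y' Z Z' : NCRingedSpace.{u}} {β : X ⟶ Y} {γ : X ⟶ Y'}
    (f : Y ⟶ Z) (g : Y' ⟶ Z') {E : ℤ → Mod Z} {F : ℤ → Mod Z'} (h : q = s)
    (x : GrHom q (pb (β ≫ f) E) (pb (γ ≫ g) F)) :
    unsplit f g (GrHom.cast h x) = GrHom.cast h (unsplit f g x) := rfl

/-- Compatibility of inverse images with a commutative square `f₁ ≫ b = a ≫ f₂`. -/
lemma unsplit_pull_pull {q : ℤ} {X Y X' Y' T T' Z Z' : NCRingedSpace.{u}}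
    (f₁ : X ⟶ X') (b : X' ⟶ Y') (a : X ⟶ Y) (f₂ : Y ⟶ Y') (w : f₁ ≫ b = a ≫ f₂)
    (f : T ⟶ Z) (g : T' ⟶ Z') {β : Y' ⟶ Z} {γ : Y' ⟶ Z'} {β₁ : Y ⟶ T} {γ₁ : Y ⟶ T'}
    {β₂ : X ⟶ T} {γ₂ : X ⟶ T'} {β₃ : X' ⟶ Z} {γ₃ : X' ⟶ Z'}
    (h₁ : b ≫ β = β₃) (h₁' : b ≫ γ = γ₃) (h₂ : f₁ ≫ β₃ = β₂ ≫ f) (h₂' : f₁ ≫ γ₃ = γ₂ ≫ g)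
    (h₃ : f₂ ≫ β = β₁ ≫ f) (h₃' : f₂ ≫ γ = γ₁ ≫ g) (h₄ : a ≫ β₁ = β₂) (h₄' : a ≫ γ₁ = γ₂)
    {E : ℤ → Mod Z} {F : ℤ → Mod Z'} (x : GrHom q (pb β E) (pb γ F)) :
    unsplit f g (pull f₁ h₂ h₂' (pull b h₁ h₁' x)) =
      pull a h₄ h₄' (unsplit f g (pull f₂ h₃ h₃' x)) := by
  have e₁ : a ≫ β₁ ≫ f = β₂ ≫ f := by rw [← Category.assoc, h₄]
  have e₂ : a ≫ γ₁ ≫ g = γ₂ ≫ g := by rw [← Category.assoc, h₄']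
  have e₃ : (f₁ ≫ b) ≫ β = β₂ ≫ f := by rw [Category.assoc, h₁, h₂]
  have e₄ : (f₁ ≫ b) ≫ γ = γ₂ ≫ g := by rw [Category.assoc, h₁', h₂']
  rw [pull_unsplit _ _ _ _ _ e₁ e₂, pull_pull _ _ _ rfl _ _ _ _ e₃ e₄,
    pull_pull _ _ _ w.symm _ _ _ _ e₃ e₄]

lemma cochPullback_delta (f : U ⟶ V) {E F : ℤ → Mod (V _⦋0⦌)} (x : Coch V E F m)
    (h : m + 1 = n) : cochPullback f (delta x h) = delta (cochPullback f x) h := by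
  funext k
  cases k with
  | zero => simp [cochPullback, delta]
  | succ p =>
    simp only [cochPullback, delta, map_sum, map_zsmul]
    refine Finset.sum_congr rfl fun i _ => ?_
    have w : f.app (op ⦋p + 1⦌) ≫ V.δ (i.succ.castSucc : Fin (p + 2)) =
        U.δ (i.succ.castSucc : Fin (p + 2)) ≫ f.app (op ⦋p⦌) := (f.naturality _).symm
    rw [pull_cast, unsplit_cast]
    refine congrArg (fun z => ((-1 : ℤ) ^ (i.1 + 1)) • GrHom.cast _ z) ?_
    exact (unsplit_pull_pull _ _ _ _ w _ _ _ _ _ _ _ _ _ _ _)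

lemma cochPullback_mul (f : U ⟶ V) {E F G : ℤ → Mod (V _⦋0⦌)} (x : Coch V F G m)
    (y : Coch V E F n) (h : m + n = t) :
    cochPullback f (mul x y h) = mul (cochPullback f x) (cochPullback f y) h := by
  funext k
  simp only [cochPullback, mul, map_sum, map_zsmul]
  refine Finset.sum_congr rfl fun p _ => ?_
  have e : f.app (op ⦋k⦌) ≫ rho V k p (by omega) ≫ tau V p 0 (Nat.zero_le _) =
      (rho U k p (by omega) ≫ tau U p 0 (Nat.zero_le _)) ≫ f.app (op ⦋0⦌) := by
    rw [← Category.assoc, rho_naturality, Category.assoc, tau_naturality, Category.assoc]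
  rw [pull_comp _ _ e, unsplit_comp _ (f.app (op ⦋0⦌))]
  refine congrArg (fun z => (_ : ℤ) • z) (congrArg₂ (fun z w => GrHom.comp z w _) ?_ ?_)
  · exact unsplit_pull_pull _ _ _ _ (rho_naturality f _) _ _ _ _ _ _ _ _ _ _ _
  · exact unsplit_pull_pull _ _ _ _ (tau_naturality f _) _ _ _ _ _ _ _ _ _ _ _

lemma strip_mul_zero (x : Coch U F G m) (y : Coch U E F n) (h : m + n = t) :
    strip (tau_self 0) (rho_self 0) (GrHom.cast (by simp) (mul x y h 0) : GrHom t _ _) =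
      (strip (tau_self 0) (rho_self 0) (GrHom.cast (by simp) (x 0) : GrHom m _ _)).comp
        (strip (tau_self 0) (rho_self 0) (GrHom.cast (by simp) (y 0) : GrHom n _ _)) h := by
  have e : rho U 0 0 le_rfl ≫ tau U 0 0 le_rfl = 𝟙 _ := by
    rw [rho_self, tau_self, Category.comp_id]
  have h₁ : mul x y h 0 =
      (pull (rho U 0 0 le_rfl) rfl (rho_rho _ _) (x 0)).comp
        (pull (tau U 0 0 le_rfl) (tau_tau _ _) (tau_rho le_rfl le_rfl rfl) (y 0))
        (by simpa using h) := by
    refine (Fin.sum_univ_one _).trans ?_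
    have : ((m - ((0 : Fin (0 + 1)) : ℕ)) * ((0 - ((0 : Fin (0 + 1)) : ℕ) : ℕ) : ℤ)).negOnePow
        = 1 := by simp
    rw [this]
    exact one_smul ℤ _
  rw [h₁]
  rw [GrHom.cast_comp (q₁ := m) (s₁ := n) _ _ _ (by simp) (by simp), ← pull_cast, ← pull_cast,
    strip_comp (tau_self 0) e (rho_self 0), strip_pull (rho_self 0) _ _ (tau_self 0) (rho_self 0),
    strip_pull (tau_self 0) _ _ (tau_self 0) (rho_self 0)]

end Cochains

/-! ### Twisted complexes -/

section Twisted

variable {U V : SimplicialObject NCRingedSpace.{u}}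

/-- Given `a^{0,1}`, the map of degree `1` that it induces on `β^* E`. -/
def pullDiff {E : ℤ → Mod (U _⦋0⦌)} (a : Coch U E E 1) {X : NCRingedSpace.{u}}
    (β : X ⟶ U _⦋0⦌) : GrHom 1 (pb β E) (pb β E) :=
  pull β (by rw [tau_self, Category.comp_id]) (by rw [rho_self, Category.comp_id])
    (GrHom.cast (by simp) (a 0))

/-- Twisted complexes on a simplicial ringed space: a graded sheaf of modules `E` on `U_0` and
`a = (a^{k,1-k})` of total degree `1` with `δ a + a · a = 0`, such that
`a^{1,0} : τ_{1,0}^* E ⟶ ρ_{1,0}^* E` is invertible up to homotopy, for the differentials induced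
by `a^{0,1}`. -/
structure TwistedComplex (U : SimplicialObject NCRingedSpace.{u}) where
  /-- the underlying graded sheaf -/
  E : ℤ → Mod (U _⦋0⦌)
  /-- the maps `a^{k,1-k}` -/
  a : Coch U E E 1
  maurerCartan : delta a rfl + mul a a rfl = (0 : Coch U E E 2)
  nondegenerate : GrHom.IsHomotopyInvertible (pullDiff a (tau U 1 0 zero_le_one))
    (pullDiff a (rho U 1 0 zero_le_one)) (GrHom.cast (by simp) (a 1))

namespace TwistedComplex

/-- The inverse image `f^* (E, a) = (f_0^* E, f^* a)` of a twisted complex under a simplicial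
map. -/
def pullback (f : U ⟶ V) (A : TwistedComplex V) : TwistedComplex U where
  E := pb (f.app (op ⦋0⦌)) A.E
  a := cochPullback f A.a
  maurerCartan := by
    rw [← cochPullback_delta, ← cochPullback_mul, ← cochPullback_add, A.maurerCartan,
      cochPullback_zero]
  nondegenerate := by
    have h : GrHom.IsHomotopyInvertible
        (unsplit (f.app (op ⦋0⦌)) (f.app (op ⦋0⦌)) (pull (f.app (op ⦋1⦌))
          (tau_naturality f zero_le_one) (tau_naturality f zero_le_one)
          (pullDiff A.a (tau V 1 0 zero_le_one))))
        (unsplit (f.app (op ⦋0⦌)) (f.app (op ⦋0⦌)) (pull (f.app (op ⦋1⦌))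
          (rho_naturality f zero_le_one) (rho_naturality f zero_le_one)
          (pullDiff A.a (rho V 1 0 zero_le_one))))
        (unsplit (f.app (op ⦋0⦌)) (f.app (op ⦋0⦌)) (pull (f.app (op ⦋1⦌))
          (tau_naturality f zero_le_one) (rho_naturality f zero_le_one)
          (GrHom.cast (by simp) (A.a 1)))) :=
      ((A.nondegenerate.map (TwistedCx.pullback (f.app (op ⦋1⦌)))).conj
        (fun n => tri _ _ _ (tau_naturality f zero_le_one) (A.E n))
        (fun n => tri _ _ _ (rho_naturality f zero_le_one) (A.E n))).conj
        (fun n => (tri (tau U 1 0 zero_le_one) (f.app (op ⦋0⦌)) _ rfl (A.E n)).symm)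
        (fun n => (tri (rho U 1 0 zero_le_one) (f.app (op ⦋0⦌)) _ rfl (A.E n)).symm)
    have h₁ : unsplit (f.app (op ⦋0⦌)) (f.app (op ⦋0⦌)) (pull (f.app (op ⦋1⦌))
          (tau_naturality f zero_le_one) (tau_naturality f zero_le_one)
          (pullDiff A.a (tau V 1 0 zero_le_one))) =
        pullDiff (cochPullback f A.a) (tau U 1 0 zero_le_one) :=
      unsplit_pull_pull _ _ _ _ (tau_naturality f zero_le_one) _ _ _ _ _ _ _ _ _ _ _
    have h₂ : unsplit (f.app (op ⦋0⦌)) (f.app (op ⦋0⦌)) (pull (f.app (op ⦋1⦌))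
          (rho_naturality f zero_le_one) (rho_naturality f zero_le_one)
          (pullDiff A.a (rho V 1 0 zero_le_one))) =
        pullDiff (cochPullback f A.a) (rho U 1 0 zero_le_one) :=
      unsplit_pull_pull _ _ _ _ (rho_naturality f zero_le_one) _ _ _ _ _ _ _ _ _ _ _
    rw [h₁, h₂] at h
    exact h

/-- Morphisms of degree `m` between twisted complexes. -/
abbrev Morphism (A B : TwistedComplex U) (m : ℤ) : Type u := Coch U A.E B.E m

/-- The differential `d θ = δ θ + b · θ - (-1)^m θ · a` of a morphism of degree `m`; it has
degree `n = m + 1`. -/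
def Morphism.d {A B : TwistedComplex U} {m n : ℤ} (θ : Morphism A B m) (h : m + 1 = n) :
    Morphism A B n :=
  delta θ h + mul B.a θ ((add_comm 1 m).trans h) - (m.negOnePow : ℤ) • mul θ A.a h

/-- The differential on the graded sheaf `E` given by `a^{0,1}`. -/
def diff (A : TwistedComplex U) : GrHom 1 A.E A.E :=
  strip (tau_self 0) (rho_self 0) (GrHom.cast (by simp) (A.a 0))

lemma diff_comp_diff (A : TwistedComplex U) :
    A.diff.comp A.diff rfl = (0 : GrHom 2 A.E A.E) := by
  have h := congrFun A.maurerCartan 0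
  have h₀ : delta A.a (rfl : (1 : ℤ) + 1 = 2) 0 = 0 := rfl
  rw [Pi.add_apply, Pi.zero_apply, h₀, zero_add] at h
  have h₁ := strip_mul_zero A.a A.a (rfl : (1 : ℤ) + 1 = 2)
  rw [h, map_zero, map_zero] at h₁
  exact h₁.symm

/-- The complex of sheaves of modules `(E, a^{0,1})` on `U_0`. -/
def complex (A : TwistedComplex U) : CochainComplex (Mod (U _⦋0⦌)) ℤ where
  X := A.E
  d n m := if h : n + 1 = m then A.diff.v n m h else 0
  shape n m h := dif_neg h
  d_comp_d' n k m h h' := by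
    change n + 1 = k at h
    change k + 1 = m at h'
    rw [dif_pos h, dif_pos h',
      ← GrHom.comp_v A.diff A.diff (rfl : (1 : ℤ) + 1 = 2) n k m (by omega) h h', diff_comp_diff]
    rfl

/-- The component of bidegree `(0, 0)` of a morphism of degree `0`. -/
def Morphism.zero_zero {A B : TwistedComplex U} (θ : Morphism A B 0) : GrHom 0 A.E B.E :=
  strip (tau_self 0) (rho_self 0) (GrHom.cast (by simp) (θ 0))

lemma Morphism.zero_zero_comm {A B : TwistedComplex U} (θ : Morphism A B 0)
    (h : θ.d (zero_add 1) = 0) :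
    B.diff.comp θ.zero_zero (add_zero 1) = θ.zero_zero.comp A.diff (zero_add 1) := by
  have h' := congrFun h 0
  have h₀ : delta θ (zero_add 1) 0 = 0 := rfl
  rw [d, Pi.sub_apply, Pi.add_apply, Pi.smul_apply, Pi.zero_apply, h₀, Int.negOnePow_zero,
    Units.val_one, one_smul, sub_eq_zero, zero_add] at h'
  have h₁ := strip_mul_zero B.a θ (add_zero 1)
  have h₂ := strip_mul_zero θ A.a (zero_add 1)
  rw [h', h₂] at h₁
  exact h₁.symm

/-- The chain map `(E, a^{0,1}) ⟶ (F, b^{0,1})` given by the component of bidegree `(0, 0)` of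
a closed morphism of degree `0`. -/
def Morphism.chainMap {A B : TwistedComplex U} (θ : Morphism A B 0) (h : θ.d (zero_add 1) = 0) :
    A.complex ⟶ B.complex where
  f n := θ.zero_zero.v n n (add_zero n)
  comm' n m hnm := by
    change n + 1 = m at hnm
    have := congrArg (fun x => x.v n m hnm) (θ.zero_zero_comm h)
    simp only [GrHom.comp_v _ _ _ n n m hnm (add_zero n) hnm,
      GrHom.comp_v _ _ _ n m m hnm hnm (add_zero m)] at this
    simpa [complex, hnm] using this

/-- Weak equivalences of twisted complexes: closed morphisms of degree `0` whose component of
bidegree `(0, 0)` is a quasi-isomorphism of complexes of sheaves of modules on `U_0`. -/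
structure Morphism.IsWeakEquivalence {A B : TwistedComplex U} (θ : Morphism A B 0) : Prop where
  closed : θ.d (zero_add 1) = 0
  quasiIso : QuasiIso (θ.chainMap closed)

end TwistedComplex

end Twisted

/-! ### The morphism attached to a simplicial homotopy -/

section Homotopy

variable {U V : SimplicialObject NCRingedSpace.{u}} {f g : U ⟶ V}

/-- Combinatorial simplicial homotopies `h_i : U_p ⟶ V_{p+1}`, `0 ≤ i ≤ p`, between `f` and `g`,
normalized by `∂_0 h_0 = f` and `∂_{p+1} h_p = g` (the convention in Mathlib exchanges the
two maps). -/
abbrev SimplicialHomotopy (f g : U ⟶ V) := SimplicialObject.Homotopy g f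

lemma homotopy_tau (h : SimplicialHomotopy f g) : ∀ (k : ℕ) (i : Fin (k + 1)),
    h.h i ≫ tau V (k + 1) 0 (k + 1).zero_le = tau U k 0 k.zero_le ≫ f.app (op ⦋0⦌) := by
  intro k
  induction k with
  | zero =>
    intro i
    obtain rfl : i = 0 := Subsingleton.elim (α := Fin 1) _ _
    rw [tau_succ _ _ (Nat.zero_le _), ← Category.assoc, h.h_zero_comp_δ_zero, tau_naturality]
  | succ k ih =>
    intro i
    rw [tau_succ _ _ (Nat.zero_le _), ← Category.assoc]
    cases i using Fin.cases with
    | zero => rw [h.h_zero_comp_δ_zero, tau_naturality]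
    | succ j =>
      have := h.h_succ_comp_δ_castSucc_of_lt 0 j (Fin.zero_le _)
      rw [Fin.castSucc_zero] at this
      rw [this, Category.assoc, ih, ← Category.assoc, ← tau_succ]

lemma homotopy_rho (h : SimplicialHomotopy f g) : ∀ (k : ℕ) (i : Fin (k + 1)),
    h.h i ≫ rho V (k + 1) 0 (k + 1).zero_le = rho U k 0 k.zero_le ≫ g.app (op ⦋0⦌) := by
  intro k
  induction k with
  | zero =>
    intro i
    obtain rfl : i = Fin.last 0 := Subsingleton.elim (α := Fin 1) _ _
    rw [rho_succ _ _ (Nat.zero_le _), ← Category.assoc, h.h_last_comp_δ_last, rho_naturality]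
  | succ k ih =>
    intro i
    rw [rho_succ _ _ (Nat.zero_le _), ← Category.assoc]
    cases i using Fin.lastCases with
    | last => rw [h.h_last_comp_δ_last, rho_naturality]
    | cast j =>
      have := h.h_castSucc_comp_δ_succ_of_lt (Fin.last (k + 1)) j (Fin.castSucc_lt_last j)
      rw [Fin.succ_last] at this
      rw [this, Category.assoc, ih, ← Category.assoc, ← rho_succ]

/-- The morphism `Φ₀(A) : f^* A ⟶ g^* A` of degree `0` attached to a simplicial homotopy `h`
between `f` and `g`, with components
`∑_{i=0}^k (-1)^i h_i^* a^{k+1,-k} : τ_{k,0}^* f_0^* E ⟶ ρ_{k,0}^* g_0^* E`. -/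
def homotopyMorphism (h : SimplicialHomotopy f g) (A : TwistedComplex V) :
    TwistedComplex.Morphism (A.pullback f) (A.pullback g) 0 := fun k =>
  ∑ i : Fin (k + 1), ((-1 : ℤ) ^ i.1) •
    unsplit (f.app (op ⦋0⦌)) (g.app (op ⦋0⦌))
      (pull (h.h i) (homotopy_tau h k i) (homotopy_rho h k i)
        (GrHom.cast (by push_cast; omega) (A.a (k + 1))))

end Homotopy

end TwistedCx

end

/-! Closedness is a prism argument. The maps `h_0, ..., h_k` cut the prism over `U_k` into `k + 1`
simplices; the vertices `0, ..., i` of the `i`-th one lie over `g` and the vertices `i + 1, ..., k +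
1` over `f`. Pull the Maurer-Cartan equation `δa + a·a = 0` in simplicial degree `k + 1` back along
each `h_i` and take the alternating sum over `i`.

In the `δ` part only inner faces occur. The face `∂_i` is common to `h_{i-1}` and `h_i`, where it
appears with opposite signs and cancels; every other inner face of the prism simplex `h_i` is an `h`
precomposed with an inner face of `U`. What remains is `-δΦ₀` (`sum_sum_prism`,
`sum_prismPull_delta`).

In the `a·a` part, a term cuts the simplex `h_i` at its vertex `p`. If `p ≤ i`, the front piece lies
over `g` and the back piece is the simplex `h_{i-p}` of a smaller prism; these terms add up to
`-g^*a·Φ₀`. If `p > i`, the front piece is a simplex `h_i` of a smaller prism and the back piece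
lies over `f`; these add up to `Φ₀·f^*a` (`sum_sum_split`, `sum_prismPull_mul`). Hence `-δΦ₀ -
g^*a·Φ₀ + Φ₀·f^*a = 0`, which is `-dΦ₀ = 0`.

For the quasi-isomorphism, the `(0,0)` component is `h_0^*a^{1,0}`. Inverse image need not be exact,
so it would not suffice for `a^{1,0}` to be a quasi-isomorphism; but a homotopy inverse and its
homotopies are carried along by any additive functor, so `h_0^*a^{1,0}` is a homotopy equivalence.
-/

noncomputable section

namespace TwistedCx

/-! ### Front and back faces of the simplices of a prism -/

section Faces

variable {U V : SimplicialObject NCRingedSpace.{u}} {f g : U ⟶ V}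

/-- The front faces of `h_i` with all vertices in the part of the prism lying over `g`. -/
lemma homotopy_rho_of_le (h : SimplicialHomotopy f g) {k p : ℕ} (hp : p ≤ k) (i : Fin (k + 1))
    (hi : p ≤ i) :
    h.h i ≫ rho V (k + 1) p (hp.trans k.le_succ) = rho U k p hp ≫ g.app (op ⦋p⦌) := by
  induction k with
  | zero =>
    obtain rfl : i = Fin.last 0 := Subsingleton.elim (α := Fin 1) _ _
    rw [rho_succ _ _ hp, ← Category.assoc, h.h_last_comp_δ_last, rho_naturality]
  | succ k ih =>
    rw [rho_succ _ _ hp, ← Category.assoc]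
    cases i using Fin.lastCases with
    | last => rw [h.h_last_comp_δ_last, rho_naturality]
    | cast j =>
      have hpj : p ≤ j := hi
      -- Removing the top vertex leaves a simplex of the same kind one dimension lower; `p ≤ j ≤ k`
      -- excludes `p = k + 1`, so the induction hypothesis applies.
      have hpk : p ≤ k := by omega
      have := h.h_castSucc_comp_δ_succ_of_lt (Fin.last (k + 1)) j (Fin.castSucc_lt_last j)
      rw [Fin.succ_last] at this
      rw [this, Category.assoc, ih hpk j hpj, ← Category.assoc, ← rho_succ]

/-- The front faces of `h_i` which are again of the form `h_i`. -/
lemma homotopy_rho_of_lt (h : SimplicialHomotopy f g) {k p : ℕ} (hp : p ≤ k) (i : Fin (k + 1))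
    (j : Fin (p + 1)) (hij : (i : ℕ) = j) :
    h.h i ≫ rho V (k + 1) (p + 1) (Nat.succ_le_succ hp) = rho U k p hp ≫ h.h j := by
  induction k with
  | zero =>
    obtain rfl : p = 0 := by omega
    obtain rfl : i = j := Fin.ext hij
    rw [rho_self, rho_self, Category.comp_id, Category.id_comp]
  | succ k ih =>
    -- If `p = k + 1`, both front faces are identities. Otherwise `i = j ≤ p < k + 1`, so `i` is not
    -- the last index and the top face passes through `h_i`.
    obtain rfl | hlt := hp.eq_or_lt
    · obtain rfl : i = j := Fin.ext hij
      rw [rho_self, rho_self, Category.comp_id, Category.id_comp]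
    · have hpk : p ≤ k := by omega
      obtain ⟨l, rfl⟩ : ∃ l : Fin (k + 1), i = l.castSucc := ⟨⟨i, by omega⟩, rfl⟩
      rw [rho_succ _ _ (Nat.succ_le_succ hpk), ← Category.assoc]
      have := h.h_castSucc_comp_δ_succ_of_lt (Fin.last (k + 1)) l (Fin.castSucc_lt_last l)
      rw [Fin.succ_last] at this
      rw [this, Category.assoc, ih hpk l hij, ← Category.assoc, ← rho_succ]

/-- The back faces of `h_i` with all vertices in the part of the prism lying over `f`. -/
lemma homotopy_tau_of_le (h : SimplicialHomotopy f g) {k r : ℕ} (hr : r ≤ k) (i : Fin (k + 1))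
    (hi : i + r ≤ k) :
    h.h i ≫ tau V (k + 1) r (hr.trans k.le_succ) = tau U k r hr ≫ f.app (op ⦋r⦌) := by
  induction k with
  | zero =>
    obtain rfl : i = 0 := Subsingleton.elim (α := Fin 1) _ _
    rw [tau_succ _ _ hr, ← Category.assoc, h.h_zero_comp_δ_zero, tau_naturality]
  | succ k ih =>
    rw [tau_succ _ _ hr, ← Category.assoc]
    cases i using Fin.cases with
    | zero => rw [h.h_zero_comp_δ_zero, tau_naturality]
    | succ j =>
      rw [Fin.val_succ] at hi
      have hrk : r ≤ k := by omega
      have := h.h_succ_comp_δ_castSucc_of_lt 0 j (Fin.zero_le _)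
      rw [Fin.castSucc_zero] at this
      rw [this, Category.assoc, ih hrk j (by omega), ← Category.assoc, ← tau_succ]

/-- The back faces of `h_i` which are of the form `h_j`. -/
lemma homotopy_tau_of_lt (h : SimplicialHomotopy f g) {k r : ℕ} (hr : r ≤ k) (i : Fin (k + 1))
    (j : Fin (r + 1)) (hij : (i : ℕ) + r = j + k) :
    h.h i ≫ tau V (k + 1) (r + 1) (Nat.succ_le_succ hr) = tau U k r hr ≫ h.h j := by
  induction k with
  | zero =>
    obtain rfl : r = 0 := by omega
    obtain rfl : i = j := Fin.ext hij
    rw [tau_self, tau_self, Category.comp_id, Category.id_comp]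
  | succ k ih =>
    obtain rfl | hlt := hr.eq_or_lt
    · obtain rfl : i = j := Fin.ext (by omega)
      rw [tau_self, tau_self, Category.comp_id, Category.id_comp]
    · have hrk : r ≤ k := by omega
      -- From `i + r = j + (k + 1)` and `r ≤ k` it follows that `i ≥ 1`, so removing vertex `0`
      -- lowers the index of `h` by one.
      obtain ⟨l, rfl⟩ : ∃ l : Fin (k + 1), i = l.succ :=
        ⟨⟨i - 1, by omega⟩, Fin.ext (by simp only [Fin.succ_mk]; omega)⟩
      rw [Fin.val_succ] at hij
      rw [tau_succ _ _ (Nat.succ_le_succ hrk), ← Category.assoc]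
      have := h.h_succ_comp_δ_castSucc_of_lt 0 l (Fin.zero_le _)
      rw [Fin.castSucc_zero] at this
      rw [this, Category.assoc, ih hrk l (by omega), ← Category.assoc, ← tau_succ]

end Faces

/-! ### Reindexing of double sums, in an arbitrary abelian group -/

section Sums

variable {M : Type*} [AddCommGroup M]

lemma map_sum_zsmul {N ι : Type*} [AddCommGroup N] [Fintype ι] (φ : M →+ N) (c : ι → ℤ)
    (x : ι → M) : φ (∑ i, c i • x i) = ∑ i, c i • φ (x i) := by
  simp only [map_sum, map_zsmul]

/-- Splitting a double sum along `p ≤ i` and `i < p`. -/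
lemma sum_sum_split (k : ℕ) (T : Fin (k + 1) → Fin (k + 2) → M)
    (B : ∀ p : Fin (k + 1), Fin (k - p + 1) → M) (C : ∀ p : Fin (k + 1), Fin (p + 1) → M)
    (hB : ∀ (p : Fin (k + 1)) (i : Fin (k - p + 1)) (j : Fin (k + 1)), (j : ℕ) = i + p →
      T j p.castSucc = B p i)
    (hC : ∀ (p : Fin (k + 1)) (i : Fin (p + 1)) (j : Fin (k + 1)), (j : ℕ) = i →
      T j p.succ = C p i) :
    ∑ i, ∑ p, T i p = ∑ p, ∑ i, B p i + ∑ p, ∑ i, C p i := by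
  rw [← Finset.sum_product', ← Finset.sum_filter_add_sum_filter_not _
    (fun x : Fin (k + 1) × Fin (k + 2) => (x.2 : ℕ) ≤ x.1),
    Finset.sum_sigma' _ _ B, Finset.sum_sigma' _ _ C]
  congr 1
  -- On `p ≤ i` the pair `(i, p)` corresponds to `(p, i - p)`: the back piece keeps `i - p` as its
  -- prism index.
  · refine Finset.sum_bij' (fun x hx => ⟨⟨x.2, ?_⟩, ⟨x.1 - x.2, ?_⟩⟩)
      (fun y hy => (⟨y.2 + y.1, ?_⟩, y.1.castSucc)) ?_ ?_ ?_ ?_ ?_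
    · simp at hx; omega
    · simp at hx ⊢; omega
    · have := y.2.2; omega
    · simp
    · simp
    · rintro ⟨a, b⟩ hx
      simp at hx ⊢
      apply Fin.ext; simp; omega
    · rintro ⟨a, b⟩ hx
      simp
    · rintro ⟨a, b⟩ hx
      simp at hx
      exact hB ⟨b, by omega⟩ _ a (by simp; omega)
  -- On `i < p` the pair `(i, p)` corresponds to `(p - 1, i)`: the front piece, of dimension `p`, is
  -- a simplex of the prism over dimension `p - 1`.
  · refine Finset.sum_bij' (fun x hx => ⟨⟨x.2 - 1, ?_⟩, ⟨x.1, ?_⟩⟩)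
      (fun y hy => (⟨y.2, ?_⟩, y.1.succ)) ?_ ?_ ?_ ?_ ?_
    · omega
    · simp at hx ⊢; omega
    · have := y.2.2; omega
    · simp
    · rintro ⟨a, b⟩ hx
      simp; omega
    · rintro ⟨a, b⟩ hx
      simp at hx ⊢
      apply Fin.ext; simp; omega
    · rintro ⟨a, b⟩ hx
      simp
    · rintro ⟨a, b⟩ hx
      simp at hx
      have := hC ⟨b - 1, by omega⟩ ⟨a, by simp; omega⟩ a rfl
      rw [← this]
      congr 1
      apply Fin.ext; simp; omega

/-- The cancellation of the two inner faces shared by neighbouring simplices of a prism. -/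
lemma sum_sum_prism (k : ℕ) (T : Fin (k + 2) → Fin (k + 1) → M) (B : Fin k → Fin (k + 1) → M)
    (hT : ∀ j : Fin (k + 1), T j.succ j + T j.castSucc j = 0)
    (hlt : ∀ (j : Fin k) (i : Fin (k + 1)), (j : ℕ) < i → T i.succ j.castSucc = -B j i)
    (hge : ∀ (j : Fin k) (i : Fin (k + 1)), (i : ℕ) ≤ j → T i.castSucc j.succ = -B j i) :
    ∑ i, ∑ j, T i j = -∑ j, ∑ i, B j i := by
  -- Each term on the right comes from exactly one uncancelled face, according to the side of the
  -- diagonal on which `(i, j)` lies.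
  have key : ∀ i : Fin (k + 1), ∀ j : Fin k, -B j i =
      (if (j : ℕ) < i then T i.succ j.castSucc else 0) +
        (if (i : ℕ) ≤ j then T i.castSucc j.succ else 0) := by
    intro i j
    by_cases h : (j : ℕ) < i
    · rw [if_pos h, if_neg (by omega), add_zero, hlt j i h]
    · rw [if_neg h, if_pos (by omega), zero_add, hge j i (by omega)]
  -- For a fixed face the two simplices sharing it, with indices `j.succ` and `j.castSucc`, drop
  -- out. The first is isolated as the pivot of `succAbove`; the second is then the entry `i = j`.
  have h₁ : ∀ j : Fin (k + 1), ∑ i, T i j =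
      (∑ i : Fin (k + 1), if (j : ℕ) < i then T i.succ j else 0) +
        ∑ i : Fin (k + 1), if (i : ℕ) < j then T i.castSucc j else 0 := by
    intro j
    have e : ∀ i : Fin (k + 1), T (j.succ.succAbove i) j =
        (if j = i then T j.castSucc j else 0) + ((if (j : ℕ) < i then T i.succ j else 0) +
          if (i : ℕ) < j then T i.castSucc j else 0) := by
      intro i
      obtain h | rfl | h := lt_trichotomy i j
      · rw [Fin.succAbove_of_castSucc_lt _ _ (by rw [Fin.lt_def] at h ⊢; simp; omega),
          if_neg h.ne', if_neg (by omega), if_pos (Fin.lt_def.1 h), zero_add, zero_add]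
      · rw [Fin.succAbove_of_castSucc_lt _ _ Fin.castSucc_lt_succ]
        simp
      · rw [Fin.succAbove_of_le_castSucc _ _ (by rw [Fin.lt_def] at h; simp [Fin.le_def]; omega),
          if_neg h.ne, if_neg (by omega : ¬ (i : ℕ) < j), if_pos (Fin.lt_def.1 h),
          zero_add, add_zero]
    rw [Fin.sum_univ_succAbove _ j.succ, Finset.sum_congr rfl fun i _ => e i,
      Finset.sum_add_distrib, Finset.sum_ite_eq, if_pos (Finset.mem_univ _), ← add_assoc, hT,
      zero_add, Finset.sum_add_distrib]
  rw [Finset.sum_comm]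
  simp only [← Finset.sum_neg_distrib, h₁, key, Finset.sum_add_distrib]
  congr 1
  -- The two boundary values of `j` contribute nothing: no `i` exceeds the last index here, and none
  -- is below `0` in the other sum.
  · rw [Fin.sum_univ_castSucc]
    refine add_eq_left.2 (Finset.sum_eq_zero fun i _ => if_neg ?_)
    rw [Fin.val_last]; omega
  · rw [Fin.sum_univ_succ]
    refine (add_eq_right.2 (Finset.sum_eq_zero fun i _ => if_neg (Nat.not_lt_zero _))).trans ?_
    refine Finset.sum_congr rfl fun j _ => Finset.sum_congr rfl fun i _ => ?_
    exact if_congr (by rw [Fin.val_succ]; omega) rfl rfl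

end Sums

/-! ### Inverse image along a prism simplex: inner faces and cut products -/

section Prism

variable {U V : SimplicialObject NCRingedSpace.{u}} {f g : U ⟶ V}
  {E F G : ℤ → Mod (V _⦋0⦌)} {q s t : ℤ}

/-- The inverse image along the component `h_i : U_k ⟶ V_{k+1}` of a simplicial homotopy. -/
def prismPull (h : SimplicialHomotopy f g) (k : ℕ) (i : Fin (k + 1)) :
    GrHom q (pb (tau V (k + 1) 0 (k + 1).zero_le) E) (pb (rho V (k + 1) 0 (k + 1).zero_le) F) →+
      GrHom q (pb (tau U k 0 k.zero_le) (pb (f.app (op ⦋0⦌)) E))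
        (pb (rho U k 0 k.zero_le) (pb (g.app (op ⦋0⦌)) F)) :=
  (unsplit (f.app (op ⦋0⦌)) (g.app (op ⦋0⦌))).comp
    (pull (h.h i) (homotopy_tau h k i) (homotopy_rho h k i))

lemma prismPull_pull_δ (h : SimplicialHomotopy f g) {k : ℕ} (i : Fin (k + 2)) (i' : Fin (k + 1))
    (j : Fin (k + 1)) (j' : Fin k)
    (w : h.h i ≫ V.δ (j.succ.castSucc : Fin (k + 3)) =
      U.δ (j'.succ.castSucc : Fin (k + 2)) ≫ h.h i')
    (x : GrHom q (pb (tau V (k + 1) 0 (k + 1).zero_le) E)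
      (pb (rho V (k + 1) 0 (k + 1).zero_le) F)) :
    prismPull h (k + 1) i (pull (V.δ (j.succ.castSucc : Fin (k + 3))) (δ_tau _ j) (δ_rho _ j) x) =
      pull (U.δ (j'.succ.castSucc : Fin (k + 2))) (δ_tau _ j') (δ_rho _ j')
        (prismPull h k i' x) :=
  unsplit_pull_pull _ _ _ _ w _ _ _ _ _ _ _ _ _ _ _

/-- By coherence of the canonical isomorphisms, an iterated inverse image depends only on the
composite map. Applied to the inner face shared by two neighbouring simplices. -/
lemma prismPull_pull_congr (h : SimplicialHomotopy f g) {k : ℕ} (i i' : Fin (k + 2))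
    {φ : V _⦋k + 2⦌ ⟶ V _⦋k + 1⦌} (w : h.h i ≫ φ = h.h i' ≫ φ)
    (hτ : φ ≫ tau V (k + 1) 0 (k + 1).zero_le = tau V (k + 2) 0 (k + 2).zero_le)
    (hρ : φ ≫ rho V (k + 1) 0 (k + 1).zero_le = rho V (k + 2) 0 (k + 2).zero_le)
    (x : GrHom q (pb (tau V (k + 1) 0 (k + 1).zero_le) E)
      (pb (rho V (k + 1) 0 (k + 1).zero_le) F)) :
    prismPull h (k + 1) i (pull φ hτ hρ x) = prismPull h (k + 1) i' (pull φ hτ hρ x) := by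
  have e₁ : (h.h i ≫ φ) ≫ tau V (k + 1) 0 (k + 1).zero_le =
      tau U (k + 1) 0 (k + 1).zero_le ≫ f.app (op ⦋0⦌) := by
    rw [Category.assoc, hτ, homotopy_tau]
  have e₂ : (h.h i ≫ φ) ≫ rho V (k + 1) 0 (k + 1).zero_le =
      rho U (k + 1) 0 (k + 1).zero_le ≫ g.app (op ⦋0⦌) := by
    rw [Category.assoc, hρ, homotopy_rho]
  simp only [prismPull, AddMonoidHom.comp_apply]
  rw [pull_pull _ _ _ rfl _ _ _ _ e₁ e₂, pull_pull _ _ _ w.symm _ _ _ _ e₁ e₂]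

lemma delta_homotopyMorphism_succ (h : SimplicialHomotopy f g) (A : TwistedComplex V) (k : ℕ) :
    delta (homotopyMorphism h A) (zero_add 1) (k + 1) = ∑ j : Fin k, ∑ i : Fin (k + 1),
      (((-1 : ℤ) ^ (j.1 + 1)) * ((-1 : ℤ) ^ i.1)) • GrHom.cast (by push_cast; omega)
        (pull (U.δ (j.succ.castSucc : Fin (k + 2))) (δ_tau k j) (δ_rho k j)
          (prismPull h k i (A.a (k + 1)))) := by
  refine Finset.sum_congr rfl fun j _ => ?_
  simp only [mul_smul, ← Finset.smul_sum]
  refine congrArg (fun z => ((-1 : ℤ) ^ (j.1 + 1)) • z) ?_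
  exact map_sum_zsmul ((GrHom.cast (by push_cast; omega)).comp (pull (U.δ (j.succ.castSucc : Fin (k + 2)))
    (δ_tau k j) (δ_rho k j))) _ _

/-- Shared inner faces cancel. For each surviving face, passing it through `h` lowers either the
index of `h` or the index of the face by one, and this shift produces the minus sign. -/
lemma sum_prismPull_delta (h : SimplicialHomotopy f g) (A : TwistedComplex V) (k : ℕ) :
    ∑ i : Fin (k + 1), ((-1 : ℤ) ^ i.1) • prismPull h k i
        (GrHom.cast (by push_cast; omega) (delta A.a (rfl : (1 : ℤ) + 1 = 2) (k + 1)) :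
          GrHom (1 - k) _ _) =
      -delta (homotopyMorphism h A) (zero_add 1) k := by
  cases k with
  | zero =>
    -- A `1`-simplex has no inner faces, so the sum is empty.
    have h₁ : delta A.a (rfl : (1 : ℤ) + 1 = 2) (0 + 1) = 0 := rfl
    have h₂ : delta (homotopyMorphism h A) (zero_add 1) 0 = 0 := rfl
    rw [h₂, neg_zero]
    refine Finset.sum_eq_zero fun i _ => ?_
    rw [h₁, map_zero, map_zero, smul_zero]
  | succ k =>
    let P (i : Fin (k + 2)) (j : Fin (k + 1)) : GrHom (1 - (k + 1 : ℕ))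
        (pb (tau U (k + 1) 0 (k + 1).zero_le) (pb (f.app (op ⦋0⦌)) A.E))
        (pb (rho U (k + 1) 0 (k + 1).zero_le) (pb (g.app (op ⦋0⦌)) A.E)) :=
      GrHom.cast (by push_cast; omega) (prismPull h (k + 1) i
        (pull (V.δ (j.succ.castSucc : Fin (k + 3))) (δ_tau _ j) (δ_rho _ j) (A.a (k + 1))))
    let Q (j : Fin k) (i : Fin (k + 1)) : GrHom (1 - (k + 1 : ℕ))
        (pb (tau U (k + 1) 0 (k + 1).zero_le) (pb (f.app (op ⦋0⦌)) A.E))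
        (pb (rho U (k + 1) 0 (k + 1).zero_le) (pb (g.app (op ⦋0⦌)) A.E)) :=
      GrHom.cast (by push_cast; omega) (pull (U.δ (j.succ.castSucc : Fin (k + 2)))
        (δ_tau k j) (δ_rho k j) (prismPull h k i (A.a (k + 1))))
    have hP (j : Fin (k + 1)) : P j.succ j = P j.castSucc j :=
      congrArg (GrHom.cast _) (prismPull_pull_congr h j.succ j.castSucc
        (φ := V.δ (j.succ.castSucc : Fin (k + 3))) (h.h_succ_comp_δ_castSucc_succ j)
        (δ_tau _ j) (δ_rho _ j) (A.a (k + 1)))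
    -- The index `j` stands for the face `∂_{j+1}`. The relations used are `∂_{j+1} h_{i+1} = h_i
    -- ∂_{j+1}` for `j < i` and, in `hge`, `∂_{j+2} h_i = h_i ∂_{j+1}` for `i ≤ j`.
    have hlt (j : Fin k) (i : Fin (k + 1)) (hji : (j : ℕ) < i) : P i.succ j.castSucc = Q j i :=
      congrArg (GrHom.cast _) (prismPull_pull_δ h i.succ i j.castSucc j
        (h.h_succ_comp_δ_castSucc_of_lt j.succ.castSucc i
          (by rw [Fin.le_def]; simp; omega)) (A.a (k + 1)))
    have hge (j : Fin k) (i : Fin (k + 1)) (hij : (i : ℕ) ≤ j) : P i.castSucc j.succ = Q j i :=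
      congrArg (GrHom.cast _) (prismPull_pull_δ h i.castSucc i j.succ j
        (h.h_castSucc_comp_δ_succ_of_lt j.succ.castSucc i
          (by rw [Fin.lt_def]; simp; omega)) (A.a (k + 1)))
    have key : ∑ i, ∑ j : Fin (k + 1), ((-1 : ℤ) ^ i.1 * (-1 : ℤ) ^ (j.1 + 1)) • P i j =
        -∑ j, ∑ i : Fin (k + 1), ((-1 : ℤ) ^ (j.1 + 1) * (-1 : ℤ) ^ i.1) • Q j i := by
      refine sum_sum_prism k _ _ ?_ ?_ ?_
      · intro j
        rw [hP, ← add_smul, Fin.val_succ, Fin.val_castSucc, pow_succ, mul_neg_one, neg_mul,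
          neg_add_cancel, zero_smul]
      · intro j i hji
        rw [hlt j i hji, ← neg_smul, Fin.val_succ, Fin.val_castSucc]
        congr 1
        ring
      · intro j i hij
        rw [hge j i hij, ← neg_smul, Fin.val_succ, Fin.val_castSucc]
        congr 1
        ring
    rw [delta_homotopyMorphism_succ]
    refine Eq.trans (Finset.sum_congr rfl fun i _ => ?_) key
    simp only [mul_smul, ← Finset.smul_sum]
    refine congrArg (fun z => ((-1 : ℤ) ^ i.1) • z) ?_
    simp only [delta, map_sum, map_zsmul]
    rfl

/-- The part of a product of cochains which involves the components of index `p` and `r`. -/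
def mulTerm {U : SimplicialObject NCRingedSpace.{u}} {E F G : ℤ → Mod (U _⦋0⦌)} {k p r : ℕ}
    (hk : p + r = k) (x : GrHom q (pb (tau U p 0 p.zero_le) F) (pb (rho U p 0 p.zero_le) G))
    (y : GrHom s (pb (tau U r 0 r.zero_le) E) (pb (rho U r 0 r.zero_le) F)) (h : q + s = t) :
    GrHom t (pb (tau U k 0 k.zero_le) E) (pb (rho U k 0 k.zero_le) G) :=
  (pull (rho U k p (by omega)) rfl (rho_rho _ _) x).comp
    (pull (tau U k r (by omega)) (tau_tau _ _) (tau_rho _ _ hk) y) h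

/-- The cut vertex `p` lies over `g`, and so does the whole front piece. The middle module is
therefore pulled back along `g_0`, which makes the two factors composable. -/
lemma prismPull_mulTerm_of_le (h : SimplicialHomotopy f g) {k p r : ℕ} (hk : p + r = k)
    (i : Fin (k + 1)) (j : Fin (r + 1)) (hij : (i : ℕ) = j + p)
    (x : GrHom q (pb (tau V p 0 p.zero_le) F) (pb (rho V p 0 p.zero_le) G))
    (y : GrHom s (pb (tau V (r + 1) 0 (r + 1).zero_le) E)
      (pb (rho V (r + 1) 0 (r + 1).zero_le) F)) (hq : q + s = t) :
    prismPull h k i (mulTerm (by omega) x y hq) =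
      mulTerm hk (unsplit (g.app (op ⦋0⦌)) (g.app (op ⦋0⦌))
        (pull (g.app (op ⦋p⦌)) (tau_naturality g _) (rho_naturality g _) x))
        (prismPull h r j y) hq := by
  have w₁ := homotopy_rho_of_le h (p := p) (by omega) i (by omega)
  have w₂ := homotopy_tau_of_lt h (r := r) (by omega) i j (by omega)
  have e : h.h i ≫ rho V (k + 1) p (by omega) ≫ tau V p 0 p.zero_le =
      (rho U k p (by omega) ≫ tau U p 0 p.zero_le) ≫ g.app (op ⦋0⦌) := by
    rw [← Category.assoc, w₁, Category.assoc, tau_naturality, Category.assoc]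
  simp only [prismPull, mulTerm, AddMonoidHom.comp_apply]
  rw [pull_comp _ _ e, unsplit_comp _ (g.app (op ⦋0⦌))]
  refine congrArg₂ (fun z w => GrHom.comp z w _) ?_ ?_
  · exact unsplit_pull_pull _ _ _ _ w₁ _ _ _ _ _ _ _ _ _ _ _
  · exact unsplit_pull_pull _ _ _ _ w₂ _ _ _ _ _ _ _ _ _ _ _

/-- Here the cut vertex is `p + 1 > i`, which lies over `f` together with the whole back piece, so
the middle module is pulled back along `f_0`. -/
lemma prismPull_mulTerm_of_lt (h : SimplicialHomotopy f g) {k p r : ℕ} (hk : p + r = k)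
    (i : Fin (k + 1)) (j : Fin (p + 1)) (hij : (i : ℕ) = j)
    (x : GrHom q (pb (tau V (p + 1) 0 (p + 1).zero_le) F)
      (pb (rho V (p + 1) 0 (p + 1).zero_le) G))
    (y : GrHom s (pb (tau V r 0 r.zero_le) E) (pb (rho V r 0 r.zero_le) F)) (hq : q + s = t) :
    prismPull h k i (mulTerm (by omega) x y hq) =
      mulTerm hk (prismPull h p j x) (unsplit (f.app (op ⦋0⦌)) (f.app (op ⦋0⦌))
        (pull (f.app (op ⦋r⦌)) (tau_naturality f _) (rho_naturality f _) y)) hq := by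
  have w₁ := homotopy_rho_of_lt h (p := p) (by omega) i j hij
  have w₂ := homotopy_tau_of_le h (r := r) (by omega) i (by omega)
  have e : h.h i ≫ rho V (k + 1) (p + 1) (by omega) ≫ tau V (p + 1) 0 (p + 1).zero_le =
      (rho U k p (by omega) ≫ tau U p 0 p.zero_le) ≫ f.app (op ⦋0⦌) := by
    rw [← Category.assoc, w₁, Category.assoc, homotopy_tau, Category.assoc]
  simp only [prismPull, mulTerm, AddMonoidHom.comp_apply]
  rw [pull_comp _ _ e, unsplit_comp _ (f.app (op ⦋0⦌))]
  refine congrArg₂ (fun z w => GrHom.comp z w _) ?_ ?_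
  · exact unsplit_pull_pull _ _ _ _ w₁ _ _ _ _ _ _ _ _ _ _ _
  · exact unsplit_pull_pull _ _ _ _ w₂ _ _ _ _ _ _ _ _ _ _ _

end Prism

/-! ### Biadditivity of composition and of the terms of a product -/

namespace GrHom

variable {C : Type u} [Category.{v} C] [Preadditive C] {q s t : ℤ} {E F G : ℤ → C}

lemma comp_add (x : GrHom q F G) (y y' : GrHom s E F) (h : q + s = t) :
    x.comp (y + y') h = x.comp y h + x.comp y' h :=
  ext_v fun _ _ _ => Preadditive.add_comp _ _ _ _ _ _

lemma add_comp (x x' : GrHom q F G) (y : GrHom s E F) (h : q + s = t) :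
    (x + x').comp y h = x.comp y h + x'.comp y h :=
  ext_v fun _ _ _ => Preadditive.comp_add _ _ _ _ _ _

end GrHom

section Products

variable {U : SimplicialObject NCRingedSpace.{u}} {E F G : ℤ → Mod (U _⦋0⦌)} {k p r : ℕ}
  {q s t q₁ s₁ t₁ : ℤ}

lemma mul_apply {m n t : ℤ} (x : Coch U F G m) (y : Coch U E F n) (h : m + n = t) (k : ℕ) :
    mul x y h k = ∑ p : Fin (k + 1), (((m - (p : ℕ)) * ((k - p : ℕ) : ℤ)).negOnePow : ℤ) •
      mulTerm (by omega) (x p) (y (k - p)) (by omega) := rfl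

lemma mulTerm_cast (hk : p + r = k)
    (x : GrHom q (pb (tau U p 0 p.zero_le) F) (pb (rho U p 0 p.zero_le) G))
    (y : GrHom s (pb (tau U r 0 r.zero_le) E) (pb (rho U r 0 r.zero_le) F)) (h : q + s = t)
    (hq : q = q₁) (hs : s = s₁) (ht : t = t₁) :
    GrHom.cast ht (mulTerm hk x y h) =
      mulTerm hk (GrHom.cast hq x) (GrHom.cast hs y) (by omega) := by
  subst hq hs ht
  rfl

lemma mulTerm_sum_right {ι : Type*} [Fintype ι] (hk : p + r = k)
    (x : GrHom q (pb (tau U p 0 p.zero_le) F) (pb (rho U p 0 p.zero_le) G)) (c : ι → ℤ)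
    (y : ι → GrHom s (pb (tau U r 0 r.zero_le) E) (pb (rho U r 0 r.zero_le) F))
    (h : q + s = t) :
    mulTerm hk x (∑ i, c i • y i) h = ∑ i, c i • mulTerm hk x (y i) h :=
  map_sum_zsmul (AddMonoidHom.mk' (fun y => mulTerm hk x y h) fun y y' => by
    rw [mulTerm, map_add, GrHom.comp_add]
    rfl) c y

lemma mulTerm_sum_left {ι : Type*} [Fintype ι] (hk : p + r = k) (c : ι → ℤ)
    (x : ι → GrHom q (pb (tau U p 0 p.zero_le) F) (pb (rho U p 0 p.zero_le) G))
    (y : GrHom s (pb (tau U r 0 r.zero_le) E) (pb (rho U r 0 r.zero_le) F)) (h : q + s = t) :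
    mulTerm hk (∑ i, c i • x i) y h = ∑ i, c i • mulTerm hk (x i) y h :=
  map_sum_zsmul (AddMonoidHom.mk' (fun x => mulTerm hk x y h) fun x x' => by
    rw [mulTerm, map_add, GrHom.add_comp]
    rfl) c x

end Products

/-! ### The product part of the Maurer-Cartan equation, and closedness -/

section Prism

variable {U V : SimplicialObject NCRingedSpace.{u}} {f g : U ⟶ V}

/-- The separate variable `r'` allows the application with `k + 1 - p`, which equals `(k - p) + 1`
only propositionally. -/
lemma prismPull_mulTerm_a_of_le (h : SimplicialHomotopy f g) (A : TwistedComplex V) {k p r r' : ℕ}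
    (hk : p + r = k) (hr' : r' = r + 1) (i : Fin (k + 1)) (j : Fin (r + 1))
    (hij : (i : ℕ) = j + p) :
    (GrHom.cast (by omega) (prismPull h k i
        (mulTerm (by omega) (A.a p) (A.a r') (rfl : _ = (1 - (p : ℤ)) + (1 - (r' : ℤ))))) :
          GrHom (1 - k) _ _) =
      mulTerm hk (cochPullback g A.a p)
        (prismPull h r j (GrHom.cast (by push_cast; omega) (A.a (r + 1))) : GrHom (0 - r) _ _)
        (by omega) := by
  subst hr'
  rw [prismPull_mulTerm_of_le h hk i j hij]
  exact mulTerm_cast hk _ _ _ rfl (by omega) _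

lemma prismPull_mulTerm_a_of_lt (h : SimplicialHomotopy f g) (A : TwistedComplex V) {k p r : ℕ}
    (hk : p + r = k) (i : Fin (k + 1)) (j : Fin (p + 1)) (hij : (i : ℕ) = j) :
    (GrHom.cast (by push_cast; omega) (prismPull h k i
        (mulTerm (by omega) (A.a (p + 1)) (A.a r)
          (rfl : _ = (1 - ((p + 1 : ℕ) : ℤ)) + (1 - (r : ℤ))))) : GrHom (1 - k) _ _) =
      mulTerm hk
        (prismPull h p j (GrHom.cast (by push_cast; omega) (A.a (p + 1))) : GrHom (0 - p) _ _)
        (cochPullback f A.a r) (by omega) := by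
  rw [prismPull_mulTerm_of_lt h hk i j hij]
  exact mulTerm_cast hk _ _ _ (by push_cast; omega) rfl _

/-- Each simplex of the prism is cut at each vertex, and the pairs (simplex, vertex) are sorted by
whether the vertex lies over `g` or over `f`. In the definitions below, `B` collects the first kind
and `C` the second. -/
lemma sum_prismPull_mul (h : SimplicialHomotopy f g) (A : TwistedComplex V) (k : ℕ) :
    ∑ i : Fin (k + 1), ((-1 : ℤ) ^ i.1) • prismPull h k i
        (GrHom.cast (by push_cast; omega) (mul A.a A.a (rfl : (1 : ℤ) + 1 = 2) (k + 1)) :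
          GrHom (1 - k) _ _) =
      -mul (A.pullback g).a (homotopyMorphism h A) (add_zero 1) k +
        mul (homotopyMorphism h A) (A.pullback f).a (zero_add 1) k := by
  let P (i : Fin (k + 1)) (p : Fin (k + 2)) : GrHom (1 - k)
      (pb (tau U k 0 k.zero_le) (pb (f.app (op ⦋0⦌)) A.E))
      (pb (rho U k 0 k.zero_le) (pb (g.app (op ⦋0⦌)) A.E)) :=
    GrHom.cast (by push_cast [show (p : ℕ) ≤ k + 1 by omega]; omega) (prismPull h k i
      (mulTerm (show (p : ℕ) + (k + 1 - p) = k + 1 by omega) (A.a p) (A.a (k + 1 - p)) rfl))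
  let B (p : Fin (k + 1)) (i : Fin (k - p + 1)) : GrHom (1 - k)
      (pb (tau U k 0 k.zero_le) (pb (f.app (op ⦋0⦌)) A.E))
      (pb (rho U k 0 k.zero_le) (pb (g.app (op ⦋0⦌)) A.E)) :=
    mulTerm (by omega) (cochPullback g A.a p)
      (prismPull h (k - p) i (GrHom.cast (by push_cast; omega) (A.a (k - p + 1))) :
        GrHom (0 - (k - p : ℕ)) _ _) (by omega)
  let C (p : Fin (k + 1)) (i : Fin (p + 1)) : GrHom (1 - k)
      (pb (tau U k 0 k.zero_le) (pb (f.app (op ⦋0⦌)) A.E))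
      (pb (rho U k 0 k.zero_le) (pb (g.app (op ⦋0⦌)) A.E)) :=
    mulTerm (by omega)
      (prismPull h p i (GrHom.cast (by push_cast; omega) (A.a (p + 1))) : GrHom (0 - (p : ℕ)) _ _)
      (cochPullback f A.a (k - p)) (by omega)
  have key : ∑ i : Fin (k + 1), ∑ p : Fin (k + 2), ((-1 : ℤ) ^ i.1 *
      (((1 - (p : ℕ)) * ((k + 1 - p : ℕ) : ℤ)).negOnePow : ℤ)) • P i p =
      ∑ p : Fin (k + 1), ∑ i : Fin (k - p + 1),
        (-((((1 - (p : ℕ)) * ((k - p : ℕ) : ℤ)).negOnePow : ℤ) * (-1 : ℤ) ^ i.1)) • B p i +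
      ∑ p : Fin (k + 1), ∑ i : Fin (p + 1),
        ((((0 - (p : ℕ)) * ((k - p : ℕ) : ℤ)).negOnePow : ℤ) * (-1 : ℤ) ^ i.1) • C p i := by
    refine sum_sum_split k _ _ _ ?_ ?_
    · intro p i j hj
      have e : P j p.castSucc = B p i :=
        prismPull_mulTerm_a_of_le h A (p := p) (r := k - p) (by omega)
          (by rw [Fin.val_castSucc]; omega) j i hj
      rw [e]
      refine congrArg (fun z : ℤ => z • B p i) ?_
      have e' : ((k + 1 - (p.castSucc : Fin (k + 2)) : ℕ) : ℤ) = ((k - p : ℕ) : ℤ) + 1 := by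
        rw [Fin.val_castSucc]; omega
      rw [e', Fin.val_castSucc, mul_add, mul_one, Int.negOnePow_add, Int.negOnePow_sub,
        Int.negOnePow_one, hj, pow_add]
      push_cast
      rw [Int.coe_negOnePow_natCast]
      -- Lengthening the back factor by one adds `1 - p` to the exponent, and writing the index as
      -- `i + p` adds another `p`. The two factors `(-1)^p` cancel and a single minus sign is left.
      have := pow_mul_pow_eq_one (p : ℕ) (show (-1 : ℤ) * -1 = 1 by norm_num)
      linear_combination (-((1 - (p : ℤ)) * ((k - p : ℕ) : ℤ)).negOnePow * (-1 : ℤ) ^ (i : ℕ)) * this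
    · intro p i j hj
      have e : P j p.succ = C p i := by
        obtain ⟨p, hp⟩ := p
        -- The index `k + 1 - (p + 1)` occurs in types; replacing it by a variable lets the equality
        -- with `k - p` be substituted.
        have : ∀ r r' (hr : r' = r) (hk : p + r = k),
            (GrHom.cast (by push_cast; omega) (prismPull h k j
            (mulTerm (by omega) (A.a (p + 1)) (A.a r')
            (rfl : _ = (1 - ((p + 1 : ℕ) : ℤ)) + (1 - (r' : ℤ))))) : GrHom (1 - k) _ _) =
            mulTerm hk
              (prismPull h p i (GrHom.cast (by push_cast; omega) (A.a (p + 1))) :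
                GrHom (0 - p) _ _)
              (cochPullback f A.a r) (by omega) := by
          rintro r _ rfl hk
          exact prismPull_mulTerm_a_of_lt h A hk j i hj
        exact this _ _ (by simp) (by simp; omega)
      rw [e]
      -- No sign arises in this case: `1 - (p + 1) = 0 - p` is the internal degree of the component
      -- of `Φ₀` of index `p`, and the length of the back factor is unchanged.
      refine congrArg (fun z : ℤ => z • C p i) ?_
      have e' : ((k + 1 - (p.succ : Fin (k + 2)) : ℕ) : ℤ) = ((k - p : ℕ) : ℤ) := by
        rw [Fin.val_succ]; omega
      rw [e', Fin.val_succ, hj, mul_comm]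
      congr 4
      push_cast
      ring
  simp only [neg_smul, Finset.sum_neg_distrib] at key
  refine Eq.trans (Finset.sum_congr rfl fun i _ => ?_) (key.trans ?_)
  · simp only [mul_smul, ← Finset.smul_sum]
    refine congrArg (fun z => ((-1 : ℤ) ^ i.1) • z) ?_
    rw [mul_apply]
    simp only [map_sum, map_zsmul]
    rfl
  · refine congrArg₂ (fun z w => -z + w) (Finset.sum_congr rfl fun p _ => ?_)
      (Finset.sum_congr rfl fun p _ => ?_)
    · simp only [mul_smul, ← Finset.smul_sum]
      refine congrArg (fun z => (_ : ℤ) • z) ?_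
      exact (mulTerm_sum_right _ _ _ _ _).symm
    · simp only [mul_smul, ← Finset.smul_sum]
      refine congrArg (fun z => (_ : ℤ) • z) ?_
      exact (mulTerm_sum_left _ _ _ _ _).symm

lemma homotopyMorphism_closed (h : SimplicialHomotopy f g) (A : TwistedComplex V) :
    TwistedComplex.Morphism.d (homotopyMorphism h A) (zero_add 1) = 0 := by
  funext k
  have e : ∑ i : Fin (k + 1), ((-1 : ℤ) ^ i.1) • prismPull h k i
      (GrHom.cast (by push_cast; omega)
        ((delta A.a rfl + mul A.a A.a rfl : Coch V A.E A.E 2) (k + 1)) :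
        GrHom (1 - k) _ _) = 0 := by
    refine Finset.sum_eq_zero fun i _ => ?_
    -- The same alternating sum is evaluated twice: as zero here, and through its `δ` and product
    -- parts in `e₁` and `e₂`.
    rw [A.maurerCartan, Pi.zero_apply, map_zero, map_zero, smul_zero]
  have e₁ := sum_prismPull_delta h A k
  have e₂ := sum_prismPull_mul h A k
  simp only [Pi.add_apply, map_add, smul_add, Finset.sum_add_distrib] at e
  have e₃ := (congrArg₂ (· + ·) e₁ e₂).symm.trans e
  rw [TwistedComplex.Morphism.d, Int.negOnePow_zero, Units.val_one, one_smul]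
  have aux {M : Type u} [AddCommGroup M] (x y z : M) (w : -x + (-y + z) = 0) :
      x + y - z = 0 := by
    rw [← neg_eq_zero, ← w]
    abel
  exact aux _ _ _ e₃

end Prism

/-! ### The `(0,0)` component is a homotopy equivalence -/

section QuasiIso

variable {U V : SimplicialObject NCRingedSpace.{u}} {f g : U ⟶ V}

/-- A closed morphism of degree `0` whose component of bidegree `(0, 0)` is invertible up to
homotopy is a homotopy equivalence on the underlying complexes. -/
lemma TwistedComplex.Morphism.quasiIso_of_isHomotopyInvertible {A B : TwistedComplex U}
    (θ : Morphism A B 0) (hθ : θ.d (zero_add 1) = 0)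
    (hinv : GrHom.IsHomotopyInvertible A.diff B.diff θ.zero_zero) :
    QuasiIso (θ.chainMap hθ) := by
  obtain ⟨y, σ, τ, hy, hσ, hτ⟩ := hinv
  let ψ : B.complex ⟶ A.complex :=
    { f := fun n => y.v n n (add_zero n)
      comm' := fun n m hnm => by
        change n + 1 = m at hnm
        have := congrArg (fun x => x.v n m hnm) hy
        simp only [GrHom.comp_v _ _ _ n n m hnm (add_zero n) hnm,
          GrHom.comp_v _ _ _ n m m hnm hnm (add_zero m)] at this
        simpa [complex, hnm] using this }
  -- Translates an identity `z - 1 = dσ + σd` of graded maps into a chain homotopy; it serves for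
  -- both composites.
  have homot {C : TwistedComplex U} (z : GrHom 0 C.E C.E) (φ : C.complex ⟶ C.complex)
      (hφ : ∀ n, φ.f n = z.v n n (add_zero n)) (σ : GrHom (-1) C.E C.E)
      (hz : z - GrHom.one C.E = C.diff.comp σ (add_neg_cancel 1) +
        σ.comp C.diff (neg_add_cancel 1)) : Nonempty (Homotopy φ (𝟙 _)) := by
    refine ⟨⟨fun n m => if hm : m + 1 = n then σ.v n m (by omega) else 0, ?_, ?_⟩⟩
    · intro n m hnm
      exact dif_neg hnm
    · intro n
      have := congrArg (fun x => x.v n n (add_zero n)) hz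
      simp only [GrHom.sub_v, GrHom.add_v, GrHom.one_v,
        GrHom.comp_v C.diff σ (add_neg_cancel 1) n (n - 1) n (add_zero n) (by omega) (by omega),
        GrHom.comp_v σ C.diff (neg_add_cancel 1) n (n + 1) n (add_zero n) rfl (by omega)] at this
      rw [sub_eq_iff_eq_add] at this
      rw [hφ, this, add_comm (σ.v n (n - 1) _ ≫ _),
        dNext_eq _ (show (ComplexShape.up ℤ).Rel n (n + 1) from rfl),
        prevD_eq _ (show (ComplexShape.up ℤ).Rel (n - 1) n from by simp)]
      simp [complex]
      rfl
  obtain ⟨h₁⟩ := homot (y.comp θ.zero_zero (zero_add 0)) (θ.chainMap hθ ≫ ψ)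
    (fun n => (GrHom.comp_v y θ.zero_zero (zero_add 0) n n n (add_zero n) (add_zero n)
      (add_zero n)).symm) σ hσ
  obtain ⟨h₂⟩ := homot (θ.zero_zero.comp y (zero_add 0)) (ψ ≫ θ.chainMap hθ)
    (fun n => (GrHom.comp_v θ.zero_zero y (zero_add 0) n n n (add_zero n) (add_zero n)
      (add_zero n)).symm) τ hτ
  exact (HomotopyEquiv.mk _ ψ h₁ h₂).quasiIso_hom

/-- The nondegeneracy of `a^{1,0}` is pulled back along `h_0 : U_0 ⟶ V_1`. Since `h_0` followed by
`τ_{1,0}` is `f_0` and followed by `ρ_{1,0}` is `g_0`, the differentials become those of the two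
inverse images. -/
lemma homotopyMorphism_isHomotopyInvertible (h : SimplicialHomotopy f g) (A : TwistedComplex V) :
    GrHom.IsHomotopyInvertible (A.pullback f).diff (A.pullback g).diff
      (homotopyMorphism h A).zero_zero := by
  -- One additive functor, then three transports along canonical isomorphisms: those of `pull`,
  -- `unsplit` and `strip`, in this order. Invertibility up to homotopy survives each.
  have h₀ := (((A.nondegenerate.map (pullback (h.h (0 : Fin 1)))).conj
        (fun n => tri _ _ _ (homotopy_tau h 0 0) (A.E n))
        (fun n => tri _ _ _ (homotopy_rho h 0 0) (A.E n))).conj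
        (fun n => (tri (tau U 0 0 le_rfl) (f.app (op ⦋0⦌)) _ rfl (A.E n)).symm)
        (fun n => (tri (rho U 0 0 le_rfl) (g.app (op ⦋0⦌)) _ rfl (A.E n)).symm)).conj
        (fun n => idIso (tau_self 0) ((pullback (f.app (op ⦋0⦌))).obj (A.E n)))
        (fun n => idIso (rho_self 0) ((pullback (g.app (op ⦋0⦌))).obj (A.E n)))
  have e₁ : strip (tau_self 0) (tau_self 0)
      (unsplit (f.app (op ⦋0⦌)) (f.app (op ⦋0⦌)) (pull (h.h (0 : Fin 1)) (homotopy_tau h 0 0)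
        (homotopy_tau h 0 0) (pullDiff A.a (tau V 1 0 zero_le_one)))) =
      (A.pullback f).diff := by
    refine (congrArg (strip _ _) (unsplit_pull_pull (h.h (0 : Fin 1)) (tau V 1 0 zero_le_one)
      (tau U 0 0 le_rfl) (f.app (op ⦋0⦌)) (homotopy_tau h 0 0) _ _ _ _ _ _
      (tau_naturality f le_rfl) (rho_naturality f le_rfl)
      (by rw [tau_self, Category.comp_id]) (by rw [rho_self, Category.comp_id]) _)).trans ?_
    exact strip_pull (tau_self 0) _ _ (tau_self 0) (rho_self 0) _ _ _
  have e₂ : strip (rho_self 0) (rho_self 0)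
      (unsplit (g.app (op ⦋0⦌)) (g.app (op ⦋0⦌)) (pull (h.h (0 : Fin 1)) (homotopy_rho h 0 0)
        (homotopy_rho h 0 0) (pullDiff A.a (rho V 1 0 zero_le_one)))) =
      (A.pullback g).diff := by
    refine (congrArg (strip _ _) (unsplit_pull_pull (h.h (0 : Fin 1)) (rho V 1 0 zero_le_one)
      (rho U 0 0 le_rfl) (g.app (op ⦋0⦌)) (homotopy_rho h 0 0) _ _ _ _ _ _
      (tau_naturality g le_rfl) (rho_naturality g le_rfl)
      (by rw [tau_self, Category.comp_id]) (by rw [rho_self, Category.comp_id]) _)).trans ?_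
    exact strip_pull (rho_self 0) _ _ (tau_self 0) (rho_self 0) _ _ _
  have e₃ : strip (tau_self 0) (rho_self 0)
      (unsplit (f.app (op ⦋0⦌)) (g.app (op ⦋0⦌)) (pull (h.h (0 : Fin 1)) (homotopy_tau h 0 0)
        (homotopy_rho h 0 0) (GrHom.cast (by simp) (A.a 1)))) =
      (homotopyMorphism h A).zero_zero := by
    -- For `k = 0` the alternating sum has the single term `i = 0`, with sign `1`.
    have e : homotopyMorphism h A 0 =
        prismPull h 0 0 (GrHom.cast (by simp) (A.a 1)) := by
      refine (Fin.sum_univ_one _).trans ?_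
      exact one_smul ℤ _
    rw [TwistedComplex.Morphism.zero_zero, e]
    rfl
  rw [← e₁, ← e₂, ← e₃]
  exact h₀

end QuasiIso

end TwistedCx

end

theorem proposition3p5 {U V : CategoryTheory.SimplicialObject TwistedCx.NCRingedSpace.{u}}
    {f g : U ⟶ V} (h : TwistedCx.SimplicialHomotopy f g) (A : TwistedCx.TwistedComplex V) :
    TwistedCx.TwistedComplex.Morphism.IsWeakEquivalence (TwistedCx.homotopyMorphism h A) :=
  ⟨TwistedCx.homotopyMorphism_closed h A,
    TwistedCx.TwistedComplex.Morphism.quasiIso_of_isHomotopyInvertible _ _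
      (TwistedCx.homotopyMorphism_isHomotopyInvertible h A)⟩
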